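/- Let $N\ge 2$, let $\omega\subset\mathbb R^{N-1}$ be a nonempty open set, and let $\Omega=(0,1)\times\omega$, with generic point $X=(x,x_1,\dots,x_{N-1})$. Let $a>0$ and let $b,c,d\in L^\infty(0,1)$ be real-valued with $b\ge 0$ and $d\ge 0$ almost everywhere; they are regarded as functions on $\Omega$ depending on the first variable $x$ only. All function spaces consist of complex-valued functions; $H_0^1(\Omega)$ is the closure of $C_c^\infty(\Omega)$ in $H^1(\Omega)$. Let $$\mathcal H=\left(H_0^1(\Omega)\times L^2(\Omega)\right)^2,\qquad \langle\Phi,\Phi_1\rangle_{\mathcal H}=\int_\Omega\left(\nabla\phi\cdot\nabla\overline{\phi_1}+v\,\overline{v_1}+a\,\nabla\psi\cdot\nabla\overline{\psi_1}+z\,\overline{z_1}\right)dX$$ for $\Phi=(\phi,v,\psi,z)$, $\Phi_1=(\phi_1,v_1,\psi_1,z_1)$, and let $\mathcal A$ be the operator in $\mathcal H$ given by $$D(\mathcal A)=\left[D(\Delta_{\rm Dir})\times H_0^1(\Omega)\right]^2,\qquad D(\Delta_{\rm Dir})=\{u\in H_0^1(\Omega):\Delta u\in L^2(\Omega)\}\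 \text{ ($\Delta u$ in the sense of distributions)},$$ $$\mathcal A(\phi,v,\psi,z)=\left(v,\ \Delta\phi-bv-cz,\ z,\ a\Delta\psi-dz+cv\right).$$ Then the following hold. 1. $\mathcal A$ is m-dissipative in $\mathcal H$: $\operatorname{Re}\langle\mathcal A\Phi,\Phi\rangle_{\mathcal H}\le 0$ for all $\Phi\in D(\mathcal A)$, and $\lambda I-\mathcal A$ maps $D(\mathcal A)$ onto $\mathcal H$ for every $\lambda>0$. 2. $\mathcal A$ is the infinitesimal generator of a $C_0$-semigroup of contractions $(e^{t\mathcal A})_{t\ge 0}$ on $\mathcal H$. 3. For every $\Phi_0\in\mathcal H$ the Cauchy problem $\Phi_t=\mathcal A\Phi$, $\Phi(0)=\Phi_0$, has a unique weak solution $\Phi\in C(\mathbb R_+,\mathcal H)$, namely $\Phi(t)=e^{t\mathcal A}\Phi_0$. Here a weak solution is a function $\Phi\in C(\mathbb R_+,\mathcal H)$ with $\Phi(0)=\Phi_0$ such that, for every $Y\in D(\mathcal A^*)$, the function $t\mapsto\langle\Phi(t),Y\rangle_{\mathcal H}$ is locally absolutely continuous with derivative $\langle\Phi(t),\mathcal A^*Y\rangle_{\mathcal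 H}$ for almost every $t$. 4. If moreover $\Phi_0\in D(\mathcal A)$, then the Cauchy problem has a unique strong solution, namely $\Phi(t)=e^{t\mathcal A}\Phi_0$, and $\Phi\in C^1(\mathbb R_+,\mathcal H)\cap C(\mathbb R_+,D(\mathcal A))$, where $D(\mathcal A)$ carries the graph norm. Here a strong solution is a function $\Phi:\mathbb R_+\to\mathcal H$ with $\Phi(0)=\Phi_0$ such that, for every $t\ge 0$, $\Phi(t)\in D(\mathcal A)$ and $\Phi$ is differentiable at $t$ (from the right at $t=0$) with $\Phi_t(t)=\mathcal A\Phi(t)$. -/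

import Mathlib

open MeasureTheory Set Filter Topology TopologicalSpace
open scoped ContDiff ENNReal InnerProductSpace

namespace CoupledWave

noncomputable section

/-! ### Test functions and Sobolev spaces -/

/-- The Euclidean space `ℝ^N`. -/
abbrev Space (N : ℕ) : Type := EuclideanSpace ℝ (Fin N)

/-- The space `L²(Ω)` of complex-valued functions. -/
abbrev L2 {N : ℕ} (Ω : Opens (Space N)) : Type :=
  Lp ℂ 2 (volume.restrict (Ω : Set (Space N)))

/-- The space `L²(Ω)^N`, with inner product `∑ i, ⟪g i, h i⟫`. -/
abbrev L2Vec {N : ℕ} (Ω : Opens (Space N)) : Type := PiLp 2 (fun _ : Fin N => L2 Ω)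

/-- `f` is a test function on `Ω`: a complex-valued smooth function with compact support
contained in `Ω`. -/
structure IsTest {N : ℕ} (Ω : Opens (Space N)) (f : Space N → ℂ) : Prop where
  smooth : ContDiff ℝ ∞ f
  compact : HasCompactSupport f
  supp : tsupport f ⊆ (Ω : Set (Space N))

/-- The partial derivative `∂ f / ∂ x_i`. -/
def pd {N : ℕ} (i : Fin N) (f : Space N → ℂ) : Space N → ℂ :=
  fun x => fderiv ℝ f x (EuclideanSpace.single i 1)

/-- The classical Laplacian `∑ i, ∂²f / ∂x_i²`. -/
def lap {N : ℕ} (f : Space N → ℂ) : Space N → ℂ := fun x => ∑ i, pd i (pd i f) x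

section TestFunctions

variable {N : ℕ} {Ω : Opens (Space N)} {f g : Space N → ℂ}

lemma IsTest.diff (hf : IsTest Ω f) : Differentiable ℝ f :=
  hf.smooth.differentiable (by simp)

lemma IsTest.zero : IsTest Ω (0 : Space N → ℂ) :=
  ⟨contDiff_const, HasCompactSupport.zero, by simp [tsupport]⟩

lemma IsTest.add (hf : IsTest Ω f) (hg : IsTest Ω g) : IsTest Ω (f + g) :=
  ⟨hf.smooth.add hg.smooth, hf.compact.add hg.compact,
    (tsupport_add f g).trans (union_subset hf.supp hg.supp)⟩

lemma IsTest.smul (hf : IsTest Ω f) (c : ℂ) : IsTest Ω (c • f) :=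
  ⟨contDiff_const.smul hf.smooth, hf.compact.smul_left (f := fun _ => c),
    (closure_mono (Function.support_const_smul_subset c f)).trans hf.supp⟩

lemma IsTest.pd (hf : IsTest Ω f) (i : Fin N) : IsTest Ω (pd i f) :=
  ⟨(hf.smooth.fderiv_right (m := ∞) (by simp)).clm_apply contDiff_const,
    hf.compact.fderiv_apply ℝ (EuclideanSpace.single i 1),
    (tsupport_fderiv_apply_subset ℝ (EuclideanSpace.single i 1)).trans hf.supp⟩

lemma IsTest.lap (hf : IsTest Ω f) : IsTest Ω (lap f) := by
  have : CoupledWave.lap f = ∑ i, CoupledWave.pd i (CoupledWave.pd i f) := by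
    funext x; simp [CoupledWave.lap]
  rw [this]
  exact Finset.sum_induction _ (IsTest Ω) (fun _ _ ha hb => ha.add hb) IsTest.zero
    (fun i _ => (hf.pd i).pd i)

lemma IsTest.memLp (hf : IsTest Ω f) (p : ℝ≥0∞) (μ : Measure (Space N))
    [IsFiniteMeasureOnCompacts μ] : MemLp f p μ :=
  hf.smooth.continuous.memLp_of_hasCompactSupport hf.compact

lemma pd_add (hf : IsTest Ω f) (hg : IsTest Ω g) (i : Fin N) : pd i (f + g) = pd i f + pd i g := by
  funext x
  simp [pd, fderiv_add (hf.diff x) (hg.diff x)]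

lemma pd_smul (hf : IsTest Ω f) (c : ℂ) (i : Fin N) : pd i (c • f) = c • pd i f := by
  funext x
  simp [pd, fderiv_const_smul (hf.diff x)]

lemma pd_zero (i : Fin N) : pd i (0 : Space N → ℂ) = 0 := by
  funext x
  simp [pd]

end TestFunctions

section Sobolev

variable {N : ℕ}

/-- The graph `{(f, ∇f)}` of the gradient on test functions, as a subspace of
`L²(Ω) × L²(Ω)^N`. -/
def testGraph (Ω : Opens (Space N)) : Submodule ℂ (L2 Ω × L2Vec Ω) where
  carrier := {p | ∃ f : Space N → ℂ, IsTest Ω f ∧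
    p.1 =ᵐ[volume.restrict (Ω : Set (Space N))] f ∧
    ∀ i, p.2 i =ᵐ[volume.restrict (Ω : Set (Space N))] pd i f}
  zero_mem' := ⟨0, IsTest.zero, Lp.coeFn_zero _ _ _, fun i => by
    rw [pd_zero]; exact Lp.coeFn_zero _ _ _⟩
  add_mem' := by
    rintro p q ⟨f, hf, hp, hp'⟩ ⟨g, hg, hq, hq'⟩
    refine ⟨f + g, hf.add hg, (Lp.coeFn_add _ _).trans (hp.add hq), fun i => ?_⟩
    rw [pd_add hf hg]
    exact (Lp.coeFn_add _ _).trans ((hp' i).add (hq' i))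
  smul_mem' := by
    rintro c p ⟨f, hf, hp, hp'⟩
    refine ⟨c • f, hf.smul c, (Lp.coeFn_smul _ _).trans (hp.const_smul c), fun i => ?_⟩
    rw [pd_smul hf]
    exact (Lp.coeFn_smul _ _).trans ((hp' i).const_smul c)

/-- The weak gradient with domain `H¹₀(Ω)`, as the closure of the gradient on test functions:
its graph is the closure of `{(f, ∇f) : f a test function}` in `L²(Ω) × L²(Ω)^N`
(see `gradient_graph`). -/
def gradient (Ω : Opens (Space N)) : L2 Ω →ₗ.[ℂ] L2Vec Ω :=
  (testGraph Ω).topologicalClosure.toLinearPMap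

/-- The Sobolev space `H¹₀(Ω)`, the closure of the test functions for the `H¹` norm,
as a subspace of `L²(Ω)`. -/
def H01 (Ω : Opens (Space N)) : Submodule ℂ (L2 Ω) := (gradient Ω).domain

/-- The gradient `∇u ∈ L²(Ω)^N` of `u ∈ H¹₀(Ω)`. -/
def grad {Ω : Opens (Space N)} : H01 Ω →ₗ[ℂ] L2Vec Ω := (gradient Ω).toFun

lemma integrable_mul_test {Ω : Opens (Space N)} (u : L2 Ω) {f : Space N → ℂ} (hf : IsTest Ω f) :
    Integrable (fun x => u x * f x) (volume.restrict (Ω : Set (Space N))) :=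
  (Lp.memLp u).integrable_mul (hf.memLp 2 _)

lemma integral_zero_mul {Ω : Opens (Space N)} (f : Space N → ℂ) :
    ∫ x in (Ω : Set (Space N)), (0 : L2 Ω) x * f x = 0 := by
  rw [← integral_zero (Space N) ℂ (μ := volume.restrict (Ω : Set (Space N)))]
  refine integral_congr_ae ?_
  filter_upwards [Lp.coeFn_zero ℂ 2 (volume.restrict (Ω : Set (Space N)))] with x hx
  rw [hx, Pi.zero_apply, zero_mul]

/-- The graph of the distributional Laplacian in `L²(Ω)`: the pairs `(u, w)` with `Δu = w` in the
sense of distributions on `Ω`, that is `∫ u Δf = ∫ w f` for all test functions `f`. -/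
def laplacianGraph (Ω : Opens (Space N)) : Submodule ℂ (L2 Ω × L2 Ω) where
  carrier := {p | ∀ f : Space N → ℂ, IsTest Ω f →
    ∫ x in (Ω : Set (Space N)), p.1 x * lap f x = ∫ x in (Ω : Set (Space N)), p.2 x * f x}
  zero_mem' := fun f _ => (integral_zero_mul _).trans (integral_zero_mul _).symm
  add_mem' := by
    intro p q hp hq f hf
    have key : ∀ (u v : L2 Ω) (g : Space N → ℂ), IsTest Ω g →
        ∫ x in (Ω : Set (Space N)), (u + v) x * g x
          = (∫ x in (Ω : Set (Space N)), u x * g x) + ∫ x in (Ω : Set (Space N)), v x * g x := by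
      intro u v g hg
      rw [← integral_add (integrable_mul_test u hg) (integrable_mul_test v hg)]
      refine integral_congr_ae ?_
      filter_upwards [Lp.coeFn_add u v] with x hx
      rw [hx, Pi.add_apply, add_mul]
    rw [Prod.fst_add, Prod.snd_add, key _ _ _ hf.lap, key _ _ _ hf, hp f hf, hq f hf]
  smul_mem' := by
    intro c p hp f hf
    have key : ∀ (u : L2 Ω) (g : Space N → ℂ),
        ∫ x in (Ω : Set (Space N)), (c • u) x * g x
          = c * ∫ x in (Ω : Set (Space N)), u x * g x := by
      intro u g
      rw [← integral_const_mul]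
      refine integral_congr_ae ?_
      filter_upwards [Lp.coeFn_smul c u] with x hx
      rw [hx, Pi.smul_apply, smul_eq_mul, mul_assoc]
    rw [Prod.smul_fst, Prod.smul_snd, key, key, hp f hf]

/-- The distributional Laplacian, with domain `{u ∈ L²(Ω) : Δu ∈ L²(Ω)}`
(see `laplacian_graph`). -/
def laplacian (Ω : Opens (Space N)) : L2 Ω →ₗ.[ℂ] L2 Ω := (laplacianGraph Ω).toLinearPMap

/-! The two graphs above are single-valued. -/

lemma eq_zero_of_integral_test {Ω : Opens (Space N)} (u : L2 Ω)
    (h : ∀ f : Space N → ℂ, IsTest Ω f → ∫ x in (Ω : Set (Space N)), u x * f x = 0) : u = 0 := by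
  rw [Lp.eq_zero_iff_ae_eq_zero]
  have hloc : LocallyIntegrableOn u (Ω : Set (Space N)) volume := by
    rw [locallyIntegrableOn_iff Ω.isOpen.isLocallyClosed]
    intro K hK hKc
    have hK2 := (Lp.memLp u).restrict K
    rw [Measure.restrict_restrict hKc.measurableSet, inter_eq_left.2 hK] at hK2
    have : IsFiniteMeasure (volume.restrict K) := ⟨by
      rw [Measure.restrict_apply_univ]; exact hKc.measure_lt_top⟩
    exact hK2.integrable (by norm_num)
  have := Ω.isOpen.ae_eq_zero_of_integral_contDiff_smul_eq_zero hloc ?_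
  · exact (ae_restrict_iff' Ω.isOpen.measurableSet).2 this
  · intro g hg hgc hgs
    have hsupp : tsupport (fun x => (g x : ℂ)) ⊆ tsupport g :=
      closure_mono fun x hx => by
        simpa using hx
    have hT : IsTest Ω (fun x => (g x : ℂ)) :=
      ⟨Complex.ofRealCLM.contDiff.comp hg, hgc.comp_left (g := fun r : ℝ => (r : ℂ)) (by simp),
        hsupp.trans hgs⟩
    rw [← h _ hT]
    rw [setIntegral_eq_integral_of_forall_compl_eq_zero (s := (Ω : Set (Space N)))]
    · refine integral_congr_ae (Eventually.of_forall fun x => ?_)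
      simp [mul_comm]
    · intro x hx
      have : g x = 0 := by
        by_contra hne
        exact hx (hgs (subset_tsupport g hne))
      simp [this]

lemma continuous_integral_test {Ω : Opens (Space N)} {f : Space N → ℂ} (hf : IsTest Ω f) :
    Continuous fun u : L2 Ω => ∫ x in (Ω : Set (Space N)), u x * f x := by
  have hm : MemLp (fun x => (starRingEnd ℂ) (f x)) 2 (volume.restrict (Ω : Set (Space N))) :=
    (hf.memLp 2 _).star
  have : (fun u : L2 Ω => ∫ x in (Ω : Set (Space N)), u x * f x)
      = fun u => ⟪hm.toLp _, u⟫_ℂ := by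
    funext u
    rw [L2.inner_def]
    refine integral_congr_ae ?_
    filter_upwards [hm.coeFn_toLp] with x hx
    rw [hx]
    simp
  rw [this]
  fun_prop

lemma gradient_weak {Ω : Opens (Space N)} {p : L2 Ω × L2Vec Ω}
    (hp : p ∈ (testGraph Ω).topologicalClosure) {f : Space N → ℂ} (hf : IsTest Ω f) (i : Fin N) :
    ∫ x in (Ω : Set (Space N)), p.1 x * pd i f x
      = - ∫ x in (Ω : Set (Space N)), p.2 i x * f x := by
  have hcl : IsClosed {q : L2 Ω × L2Vec Ω | ∫ x in (Ω : Set (Space N)), q.1 x * pd i f x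
      = - ∫ x in (Ω : Set (Space N)), q.2 i x * f x} := by
    refine isClosed_eq ((continuous_integral_test (hf.pd i)).comp continuous_fst) ?_
    exact ((continuous_integral_test hf).comp
      ((PiLp.continuous_apply 2 _ i).comp continuous_snd)).neg
  refine closure_minimal ?_ hcl hp
  rintro q ⟨g, hg, hq, hq'⟩
  have h1 : ∀ (k l : Space N → ℂ), IsTest Ω k → IsTest Ω l → Integrable (fun x => k x * l x) :=
    fun k l hk hl => (hk.memLp 2 volume).integrable_mul (hl.memLp 2 volume)
  have hs : ∀ (k l : Space N → ℂ), IsTest Ω l →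
      ∫ x in (Ω : Set (Space N)), k x * l x = ∫ x, k x * l x := by
    intro k l hl
    refine setIntegral_eq_integral_of_forall_compl_eq_zero fun x hx => ?_
    rw [image_eq_zero_of_notMem_tsupport fun h => hx (hl.supp h), mul_zero]
  have e1 : ∫ x in (Ω : Set (Space N)), q.1 x * pd i f x
      = ∫ x in (Ω : Set (Space N)), g x * pd i f x := by
    refine integral_congr_ae ?_
    filter_upwards [hq] with x hx
    rw [hx]
  have e2 : ∫ x in (Ω : Set (Space N)), q.2 i x * f x
      = ∫ x in (Ω : Set (Space N)), pd i g x * f x := by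
    refine integral_congr_ae ?_
    filter_upwards [hq' i] with x hx
    rw [hx]
  change _ = _
  rw [e1, e2, hs _ _ (hf.pd i), hs _ _ hf]
  exact integral_mul_fderiv_eq_neg_fderiv_mul_of_integrable (h1 _ _ (hg.pd i) hf)
    (h1 _ _ hg (hf.pd i)) (h1 _ _ hg hf) (fun x _ => hg.diff x) (fun x _ => hf.diff x)

lemma gradient_single {Ω : Opens (Space N)} (p : L2 Ω × L2Vec Ω)
    (hp : p ∈ (testGraph Ω).topologicalClosure) (h0 : p.1 = 0) : p.2 = 0 := by
  ext1 i
  refine eq_zero_of_integral_test _ fun f hf => ?_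
  rw [← neg_eq_zero, ← gradient_weak hp hf i, h0]
  exact integral_zero_mul _

lemma gradient_graph (Ω : Opens (Space N)) :
    (gradient Ω).graph = (testGraph Ω).topologicalClosure :=
  Submodule.toLinearPMap_graph_eq _ gradient_single

lemma mem_closure_grad {Ω : Opens (Space N)} (u : H01 Ω) :
    ((u : L2 Ω), grad u) ∈ (testGraph Ω).topologicalClosure := by
  rw [← gradient_graph]
  exact (gradient Ω).mem_graph u

lemma laplacian_graph (Ω : Opens (Space N)) : (laplacian Ω).graph = laplacianGraph Ω := by
  refine Submodule.toLinearPMap_graph_eq _ fun p hp h0 => ?_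
  refine eq_zero_of_integral_test _ fun f hf => ?_
  rw [← hp f hf, h0]
  exact integral_zero_mul _

end Sobolev

/-! ### The cylinder and the energy space -/

section Energy

variable {m : ℕ}

/-- The cylinder `(0,1) × U ⊆ ℝ^(m+1)` over `U ⊆ ℝ^m`. -/
def cyl (U : Opens (Space m)) : Opens (Space (m + 1)) where
  carrier := {X | X 0 ∈ Ioo (0 : ℝ) 1 ∧ WithLp.toLp 2 (fun i : Fin m => X i.succ) ∈ U}
  is_open' := by
    refine (isOpen_Ioo.preimage (by fun_prop)).inter (U.isOpen.preimage ?_)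
    fun_prop

/-- Poincaré inequality for test functions on the cylinder. -/
lemma poincare_test {U : Opens (Space m)} {f : Space (m + 1) → ℂ} (hf : IsTest (cyl U) f) :
    ∫ X, ‖f X‖ ^ 2 ≤ ∫ X, ‖pd 0 f X‖ ^ 2 := by
  set e : Space (m + 1) := EuclideanSpace.single 0 1 with he
  set D : Space (m + 1) → ℝ := fun X => 2 * ⟪f X, pd 0 f X⟫_ℝ with hD
  have hint : ∀ k : Space (m + 1) → ℂ, IsTest (cyl U) k → Integrable fun X => ‖k X‖ ^ 2 :=
    fun k hk => (hk.memLp 2 volume).integrable_norm_pow (by norm_num)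
  have hg : ∀ X, HasFDerivAt (fun Y => ‖f Y‖ ^ 2)
      (2 • (innerSL ℝ (f X)).comp (fderiv ℝ f X)) X := fun X => (hf.diff X).hasFDerivAt.norm_sq
  have hgD : ∀ X, fderiv ℝ (fun Y => ‖f Y‖ ^ 2) X e = D X := by
    intro X
    rw [(hg X).fderiv]
    simp [hD, pd, he]
    ring
  have hcoord : ∀ X, HasFDerivAt (fun Y : Space (m + 1) => Y 0 - 1 / 2)
      (EuclideanSpace.proj (0 : Fin (m + 1)) : Space (m + 1) →L[ℝ] ℝ) X := fun X =>
    ((EuclideanSpace.proj (0 : Fin (m + 1)) : Space (m + 1) →L[ℝ] ℝ).hasFDerivAt).sub_const _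
  have hcD : ∀ X, fderiv ℝ (fun Y : Space (m + 1) => Y 0 - 1 / 2) X e = 1 := by
    intro X
    rw [(hcoord X).fderiv]
    simp [he]
  have hDc : Continuous D :=
    continuous_const.mul (hf.smooth.continuous.inner (hf.pd 0).smooth.continuous)
  have hcs : HasCompactSupport fun X => ‖f X‖ ^ 2 :=
    hf.compact.comp_left (g := fun z : ℂ => ‖z‖ ^ 2) (by simp)
  have hcsD : HasCompactSupport D := by
    refine hf.compact.mono fun X hX => ?_
    contrapose! hX
    have : f X = 0 := by simpa using hX
    simp [hD, this]
  have hcont : Continuous fun X => ‖f X‖ ^ 2 := hf.smooth.continuous.norm.pow 2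
  have hcc : Continuous fun Y : Space (m + 1) => Y 0 - 1 / 2 := by fun_prop
  have hibp := integral_mul_fderiv_eq_neg_fderiv_mul_of_integrable (μ := volume) (𝕜 := ℝ)
    (f := fun Y : Space (m + 1) => Y 0 - 1 / 2) (g := fun Y => ‖f Y‖ ^ 2) (v := e)
    (by simpa only [hcD, one_mul] using hint f hf)
    (by
      simp only [hgD]
      exact (hcc.mul hDc).integrable_of_hasCompactSupport hcsD.mul_left)
    ((hcc.mul hcont).integrable_of_hasCompactSupport hcs.mul_left)
    (fun X _ => (hcoord X).differentiableAt) (fun X _ => (hg X).differentiableAt)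
  simp only [hcD, hgD, one_mul] at hibp
  have hbound : ∀ X, -((X 0 - 1 / 2) * D X) ≤ (1 / 2) * ‖f X‖ ^ 2 + (1 / 2) * ‖pd 0 f X‖ ^ 2 := by
    intro X
    by_cases hX : X ∈ (cyl U : Set (Space (m + 1)))
    · have hx : X 0 ∈ Ioo (0 : ℝ) 1 := hX.1
      have h1 : |X 0 - 1 / 2| ≤ 1 / 2 := by
        rw [abs_le]; constructor <;> linarith [hx.1, hx.2]
      have h2 : |D X| ≤ 2 * (‖f X‖ * ‖pd 0 f X‖) := by
        rw [hD, abs_mul, abs_of_pos (by norm_num : (0 : ℝ) < 2)]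
        exact mul_le_mul_of_nonneg_left (abs_real_inner_le_norm _ _) (by norm_num)
      have h3 : |(X 0 - 1 / 2) * D X| ≤ 1 / 2 * (2 * (‖f X‖ * ‖pd 0 f X‖)) := by
        rw [abs_mul]
        exact mul_le_mul h1 h2 (abs_nonneg _) (by norm_num)
      nlinarith [neg_abs_le ((X 0 - 1 / 2) * D X), sq_nonneg (‖f X‖ - ‖pd 0 f X‖)]
    · have : f X = 0 := image_eq_zero_of_notMem_tsupport fun h => hX (hf.supp h)
      have hD0 : D X = 0 := by simp [hD, this]
      rw [hD0]
      simp only [mul_zero, neg_zero]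
      positivity
  have hle : ∫ X, ‖f X‖ ^ 2 ≤ ∫ X, ((1 / 2) * ‖f X‖ ^ 2 + (1 / 2) * ‖pd 0 f X‖ ^ 2) := by
    have : ∫ X, ‖f X‖ ^ 2 = ∫ X, -((X 0 - 1 / 2) * D X) := by
      rw [integral_neg, hibp, neg_neg]
    rw [this]
    refine integral_mono ?_ (((hint f hf).const_mul _).add ((hint _ (hf.pd 0)).const_mul _)) hbound
    exact ((hcc.mul hDc).integrable_of_hasCompactSupport hcsD.mul_left).neg
  rw [integral_add ((hint f hf).const_mul _) ((hint _ (hf.pd 0)).const_mul _),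
    integral_const_mul, integral_const_mul] at hle
  linarith

lemma poincare_closure {U : Opens (Space m)} {p : L2 (cyl U) × L2Vec (cyl U)}
    (hp : p ∈ (testGraph (cyl U)).topologicalClosure) : ‖p.1‖ ≤ ‖p.2‖ := by
  have hcl : IsClosed {q : L2 (cyl U) × L2Vec (cyl U) | ‖q.1‖ ≤ ‖q.2‖} :=
    isClosed_le continuous_fst.norm continuous_snd.norm
  refine closure_minimal ?_ hcl hp
  rintro q ⟨f, hf, hq, hq'⟩
  change ‖q.1‖ ≤ ‖q.2‖
  have hsq : ∀ (w : L2 (cyl U)) (k : Space (m + 1) → ℂ), IsTest (cyl U) k →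
      w =ᵐ[volume.restrict (cyl U : Set (Space (m + 1)))] k → ‖w‖ ^ 2 = ∫ X, ‖k X‖ ^ 2 := by
    intro w k hk hw
    have h1 : ((‖w‖ ^ 2 : ℝ) : ℂ) = ⟪w, w⟫_ℂ := by
      rw [inner_self_eq_norm_sq_to_K]; simp
    rw [L2.inner_def] at h1
    have h2 : ∫ X in (cyl U : Set (Space (m + 1))), ⟪w X, w X⟫_ℂ
        = ∫ X in (cyl U : Set (Space (m + 1))), ((‖k X‖ ^ 2 : ℝ) : ℂ) := by
      refine integral_congr_ae ?_
      filter_upwards [hw] with X hX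
      rw [hX, inner_self_eq_norm_sq_to_K]; simp
    rw [h2, integral_complex_ofReal] at h1
    rw [Complex.ofReal_inj.1 h1]
    refine setIntegral_eq_integral_of_forall_compl_eq_zero fun X hX => ?_
    rw [image_eq_zero_of_notMem_tsupport fun h => hX (hk.supp h)]
    simp
  have h1 : ‖q.1‖ ≤ ‖q.2 0‖ := by
    refine le_of_sq_le_sq ?_ (norm_nonneg _)
    rw [hsq _ _ hf hq, hsq _ _ (hf.pd 0) (hq' 0)]
    exact poincare_test hf
  exact h1.trans (PiLp.norm_apply_le q.2 0)

/-- Poincaré inequality on `H¹₀` of the cylinder. -/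
lemma poincare {U : Opens (Space m)} (u : H01 (cyl U)) : ‖(u : L2 (cyl U))‖ ≤ ‖grad u‖ := by
  have h := poincare_closure (p := ((u : L2 (cyl U)), grad u)) (mem_closure_grad u)
  exact h

/-- The energy space `(H¹₀(Ω) × L²(Ω))²` over the cylinder `Ω = (0,1) × U`; its elements are
`Φ = (φ, v, ψ, z)`. The parameter `a` enters only through the inner product. -/
def EnergySpace (U : Opens (Space m)) {a : ℝ} (_ha : 0 < a) : Type :=
  H01 (cyl U) × L2 (cyl U) × H01 (cyl U) × L2 (cyl U)

namespace EnergySpace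

variable {U : Opens (Space m)} {a : ℝ} {ha : 0 < a}

instance : AddCommGroup (EnergySpace U ha) :=
  inferInstanceAs (AddCommGroup (H01 (cyl U) × L2 (cyl U) × H01 (cyl U) × L2 (cyl U)))

instance : Module ℂ (EnergySpace U ha) :=
  inferInstanceAs (Module ℂ (H01 (cyl U) × L2 (cyl U) × H01 (cyl U) × L2 (cyl U)))

/-- First component. -/
def phi (Φ : EnergySpace U ha) : H01 (cyl U) := Φ.1
/-- Second component. -/
def v (Φ : EnergySpace U ha) : L2 (cyl U) := Φ.2.1
/-- Third component. -/
def psi (Φ : EnergySpace U ha) : H01 (cyl U) := Φ.2.2.1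
/-- Fourth component. -/
def z (Φ : EnergySpace U ha) : L2 (cyl U) := Φ.2.2.2

/-- The energy inner product
`∫_Ω (∇φ · ∇φ₁ + v v₁ + a ∇ψ · ∇ψ₁ + z z₁)`, which is antilinear in the first variable, following
Mathlib's convention. -/
@[reducible] def core : InnerProductSpace.Core ℂ (EnergySpace U ha) where
  inner Φ Φ₁ := ⟪grad Φ.phi, grad Φ₁.phi⟫_ℂ + ⟪Φ.v, Φ₁.v⟫_ℂ
    + (a : ℂ) * ⟪grad Φ.psi, grad Φ₁.psi⟫_ℂ + ⟪Φ.z, Φ₁.z⟫_ℂ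
  conj_inner_symm Φ Φ₁ := by
    simp only [map_add, map_mul, inner_conj_symm, Complex.conj_ofReal]
  re_inner_nonneg Φ := by
    simp only [inner_self_eq_norm_sq_to_K, map_add]
    have h : RCLike.re ((a : ℂ) * ((‖grad Φ.psi‖ : ℝ) : ℂ) ^ 2) = a * ‖grad Φ.psi‖ ^ 2 := by
      rw [← Complex.ofReal_pow, ← Complex.ofReal_mul]
      exact Complex.ofReal_re _
    have h' : ∀ r : ℝ, RCLike.re ((r : ℂ) ^ 2) = r ^ 2 := fun r => by
      rw [← Complex.ofReal_pow]
      exact Complex.ofReal_re _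
    change 0 ≤ RCLike.re (((‖grad Φ.phi‖ : ℝ) : ℂ) ^ 2) + RCLike.re (((‖Φ.v‖ : ℝ) : ℂ) ^ 2)
      + RCLike.re ((a : ℂ) * ((‖grad Φ.psi‖ : ℝ) : ℂ) ^ 2) + RCLike.re (((‖Φ.z‖ : ℝ) : ℂ) ^ 2)
    rw [h, h', h', h']
    have := ha.le
    positivity
  add_left Φ Φ₁ Φ₂ := by
    change ⟪grad (Φ.phi + Φ₁.phi), grad Φ₂.phi⟫_ℂ + ⟪Φ.v + Φ₁.v, Φ₂.v⟫_ℂ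
      + (a : ℂ) * ⟪grad (Φ.psi + Φ₁.psi), grad Φ₂.psi⟫_ℂ + ⟪Φ.z + Φ₁.z, Φ₂.z⟫_ℂ = _
    simp only [map_add, inner_add_left]
    ring
  smul_left Φ Φ₁ r := by
    change ⟪grad (r • Φ.phi), grad Φ₁.phi⟫_ℂ + ⟪r • Φ.v, Φ₁.v⟫_ℂ
      + (a : ℂ) * ⟪grad (r • Φ.psi), grad Φ₁.psi⟫_ℂ + ⟪r • Φ.z, Φ₁.z⟫_ℂ = _
    simp only [map_smul, inner_smul_left]
    ring
  definite Φ h := by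
    simp only [inner_self_eq_norm_sq_to_K] at h
    have h' : ‖grad Φ.phi‖ ^ 2 + ‖Φ.v‖ ^ 2 + a * ‖grad Φ.psi‖ ^ 2 + ‖Φ.z‖ ^ 2 = 0 := by
      have := congrArg Complex.re h
      simp only [Complex.coe_algebraMap] at this
      norm_cast at this
    have p1 := sq_nonneg ‖grad Φ.phi‖
    have p2 := sq_nonneg ‖Φ.v‖
    have p3 := mul_nonneg ha.le (sq_nonneg ‖grad Φ.psi‖)
    have p4 := sq_nonneg ‖Φ.z‖
    have q1 : ‖grad Φ.phi‖ = 0 := pow_eq_zero_iff (two_ne_zero) |>.1 (by linarith)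
    have q2 : ‖Φ.v‖ = 0 := pow_eq_zero_iff (two_ne_zero) |>.1 (by linarith)
    have q3 : ‖grad Φ.psi‖ = 0 := pow_eq_zero_iff (two_ne_zero) |>.1
      ((mul_eq_zero.1 (by linarith : a * ‖grad Φ.psi‖ ^ 2 = 0)).resolve_left ha.ne')
    have q4 : ‖Φ.z‖ = 0 := pow_eq_zero_iff (two_ne_zero) |>.1 (by linarith)
    refine Prod.ext ?_ (Prod.ext ?_ (Prod.ext ?_ ?_))
    · exact Subtype.ext (norm_le_zero_iff.1 ((poincare Φ.phi).trans q1.le))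
    · exact norm_eq_zero.1 q2
    · exact Subtype.ext (norm_le_zero_iff.1 ((poincare Φ.psi).trans q3.le))
    · exact norm_eq_zero.1 q4

instance : NormedAddCommGroup (EnergySpace U ha) :=
  core.toNormedAddCommGroup

instance : InnerProductSpace ℂ (EnergySpace U ha) :=
  InnerProductSpace.ofCore core.toCore

end EnergySpace

/-! ### The damped wave operator -/

/-- The space `L^∞(0,1)` of real-valued functions. -/
abbrev LInf : Type := Lp ℝ ∞ (volume.restrict (Ioo (0 : ℝ) 1))

lemma quasi_fst (U : Opens (Space m)) :
    Measure.QuasiMeasurePreserving (fun X : Space (m + 1) => X 0)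
      (volume.restrict (cyl U : Set (Space (m + 1)))) (volume.restrict (Ioo (0 : ℝ) 1)) := by
  have h : Measure.QuasiMeasurePreserving (fun X : Space (m + 1) => X 0) volume volume :=
    (Measure.quasiMeasurePreserving_eval (fun _ : Fin (m + 1) => (volume : Measure ℝ)) 0).comp
      (PiLp.volume_preserving_ofLp (Fin (m + 1))).quasiMeasurePreserving
  exact h.restrict fun X hX => hX.1

lemma memLp_coef (U : Opens (Space m)) (b : LInf) (u : L2 (cyl U)) :
    MemLp (fun X : Space (m + 1) => (b (X 0) : ℂ) * u X) 2
      (volume.restrict (cyl U : Set (Space (m + 1)))) := by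
  have hb : MemLp (fun X : Space (m + 1) => (b (X 0) : ℂ)) ∞
      (volume.restrict (cyl U : Set (Space (m + 1)))) := by
    refine memLp_top_of_bound (C := ‖b‖) ?_ ?_
    · exact Complex.continuous_ofReal.comp_aestronglyMeasurable
        ((Lp.stronglyMeasurable b).comp_measurable (by fun_prop)).aestronglyMeasurable
    · refine (quasi_fst U).ae (p := fun x => ‖(b x : ℂ)‖ ≤ ‖b‖) ?_
      have h := ae_le_eLpNormEssSup (f := b) (μ := volume.restrict (Ioo (0 : ℝ) 1))
      filter_upwards [h] with x hx
      rw [Complex.norm_real, Lp.norm_def, eLpNorm_exponent_top, ← toReal_enorm]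
      refine ENNReal.toReal_mono ?_ hx
      rw [← eLpNorm_exponent_top]
      exact Lp.eLpNorm_ne_top b
  exact (Lp.memLp u).mul hb

/-- Multiplication by a coefficient `b ∈ L^∞(0,1)` depending on the first variable only:
`(b u)(x, x₁, …) = b(x) u(x, x₁, …)`. -/
def mulCoef (U : Opens (Space m)) (b : LInf) : L2 (cyl U) →ₗ[ℂ] L2 (cyl U) where
  toFun u := (memLp_coef U b u).toLp _
  map_add' u w := by
    rw [← MemLp.toLp_add, MemLp.toLp_eq_toLp_iff]
    filter_upwards [Lp.coeFn_add u w] with X hX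
    rw [hX, Pi.add_apply, Pi.add_apply, mul_add]
  map_smul' r u := by
    rw [RingHom.id_apply, ← MemLp.toLp_const_smul, MemLp.toLp_eq_toLp_iff]
    filter_upwards [Lp.coeFn_smul r u] with X hX
    rw [hX, Pi.smul_apply, Pi.smul_apply, smul_eq_mul, smul_eq_mul, mul_left_comm]

/-- The domain `D(A) = [D(Δ_Dir) × H¹₀(Ω)]²`, where
`D(Δ_Dir) = {u ∈ H¹₀(Ω) : Δu ∈ L²(Ω)}`. -/
def waveDomain (U : Opens (Space m)) {a : ℝ} (ha : 0 < a) :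
    Submodule ℂ (EnergySpace U ha) where
  carrier := {Φ | (Φ.phi : L2 (cyl U)) ∈ (laplacian (cyl U)).domain ∧ Φ.v ∈ H01 (cyl U) ∧
    (Φ.psi : L2 (cyl U)) ∈ (laplacian (cyl U)).domain ∧ Φ.z ∈ H01 (cyl U)}
  zero_mem' := ⟨zero_mem _, zero_mem _, zero_mem _, zero_mem _⟩
  add_mem' h h' := ⟨add_mem h.1 h'.1, add_mem h.2.1 h'.2.1, add_mem h.2.2.1 h'.2.2.1,
    add_mem h.2.2.2 h'.2.2.2⟩
  smul_mem' r _ h := ⟨Submodule.smul_mem _ r h.1, Submodule.smul_mem _ r h.2.1,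
    Submodule.smul_mem _ r h.2.2.1, Submodule.smul_mem _ r h.2.2.2⟩

/-- The operator `A (φ, v, ψ, z) = (v, Δφ - b v - c z, z, a Δψ - d z + c v)` with domain
`waveDomain`. -/
def waveOp (U : Opens (Space m)) {a : ℝ} (ha : 0 < a) (b c d : LInf) :
    EnergySpace U ha →ₗ.[ℂ] EnergySpace U ha where
  domain := waveDomain U ha
  toFun :=
    { toFun := fun Φ =>
        ((⟨Φ.1.v, Φ.2.2.1⟩ : H01 (cyl U)),
          laplacian (cyl U) ⟨Φ.1.phi, Φ.2.1⟩ - mulCoef U b Φ.1.v - mulCoef U c Φ.1.z,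
          (⟨Φ.1.z, Φ.2.2.2.2⟩ : H01 (cyl U)),
          (a : ℂ) • laplacian (cyl U) ⟨Φ.1.psi, Φ.2.2.2.1⟩ - mulCoef U d Φ.1.z
            + mulCoef U c Φ.1.v)
      map_add' := by
        intro Φ Φ₁
        have h1 : laplacian (cyl U) ⟨(Φ + Φ₁).1.phi, (Φ + Φ₁).2.1⟩
            = laplacian (cyl U) ⟨Φ.1.phi, Φ.2.1⟩ + laplacian (cyl U) ⟨Φ₁.1.phi, Φ₁.2.1⟩ :=
          (laplacian (cyl U)).map_add ⟨Φ.1.phi, Φ.2.1⟩ ⟨Φ₁.1.phi, Φ₁.2.1⟩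
        have h2 : laplacian (cyl U) ⟨(Φ + Φ₁).1.psi, (Φ + Φ₁).2.2.2.1⟩
            = laplacian (cyl U) ⟨Φ.1.psi, Φ.2.2.2.1⟩
              + laplacian (cyl U) ⟨Φ₁.1.psi, Φ₁.2.2.2.1⟩ :=
          (laplacian (cyl U)).map_add ⟨Φ.1.psi, Φ.2.2.2.1⟩ ⟨Φ₁.1.psi, Φ₁.2.2.2.1⟩
        have hv : (Φ + Φ₁).1.v = Φ.1.v + Φ₁.1.v := rfl
        have hz : (Φ + Φ₁).1.z = Φ.1.z + Φ₁.1.z := rfl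
        refine Prod.ext rfl (Prod.ext ?_ (Prod.ext rfl ?_))
        · change laplacian (cyl U) ⟨(Φ + Φ₁).1.phi, (Φ + Φ₁).2.1⟩ - mulCoef U b (Φ + Φ₁).1.v
              - mulCoef U c (Φ + Φ₁).1.z
            = (laplacian (cyl U) ⟨Φ.1.phi, Φ.2.1⟩ - mulCoef U b Φ.1.v - mulCoef U c Φ.1.z)
              + (laplacian (cyl U) ⟨Φ₁.1.phi, Φ₁.2.1⟩ - mulCoef U b Φ₁.1.v
                - mulCoef U c Φ₁.1.z)
          rw [h1, hv, hz, map_add, map_add]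
          abel
        · change (a : ℂ) • laplacian (cyl U) ⟨(Φ + Φ₁).1.psi, (Φ + Φ₁).2.2.2.1⟩
              - mulCoef U d (Φ + Φ₁).1.z + mulCoef U c (Φ + Φ₁).1.v
            = ((a : ℂ) • laplacian (cyl U) ⟨Φ.1.psi, Φ.2.2.2.1⟩ - mulCoef U d Φ.1.z
                + mulCoef U c Φ.1.v)
              + ((a : ℂ) • laplacian (cyl U) ⟨Φ₁.1.psi, Φ₁.2.2.2.1⟩ - mulCoef U d Φ₁.1.z
                + mulCoef U c Φ₁.1.v)
          rw [h2, hv, hz, map_add, map_add, smul_add]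
          abel
      map_smul' := by
        intro r Φ
        have h1 : laplacian (cyl U) ⟨(r • Φ).1.phi, (r • Φ).2.1⟩
            = r • laplacian (cyl U) ⟨Φ.1.phi, Φ.2.1⟩ :=
          (laplacian (cyl U)).map_smul r ⟨Φ.1.phi, Φ.2.1⟩
        have h2 : laplacian (cyl U) ⟨(r • Φ).1.psi, (r • Φ).2.2.2.1⟩
            = r • laplacian (cyl U) ⟨Φ.1.psi, Φ.2.2.2.1⟩ :=
          (laplacian (cyl U)).map_smul r ⟨Φ.1.psi, Φ.2.2.2.1⟩
        have hv : (r • Φ).1.v = r • Φ.1.v := rfl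
        have hz : (r • Φ).1.z = r • Φ.1.z := rfl
        refine Prod.ext rfl (Prod.ext ?_ (Prod.ext rfl ?_))
        · change laplacian (cyl U) ⟨(r • Φ).1.phi, (r • Φ).2.1⟩ - mulCoef U b (r • Φ).1.v
              - mulCoef U c (r • Φ).1.z
            = r • (laplacian (cyl U) ⟨Φ.1.phi, Φ.2.1⟩ - mulCoef U b Φ.1.v - mulCoef U c Φ.1.z)
          rw [h1, hv, hz, map_smul, map_smul, smul_sub, smul_sub]
        · change (a : ℂ) • laplacian (cyl U) ⟨(r • Φ).1.psi, (r • Φ).2.2.2.1⟩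
              - mulCoef U d (r • Φ).1.z + mulCoef U c (r • Φ).1.v
            = r • ((a : ℂ) • laplacian (cyl U) ⟨Φ.1.psi, Φ.2.2.2.1⟩ - mulCoef U d Φ.1.z
                + mulCoef U c Φ.1.v)
          rw [h2, hv, hz, map_smul, map_smul, smul_add, smul_sub, smul_comm] }

end Energy

/-! ### Dissipative operators, semigroups and solutions of the Cauchy problem -/

section Abstract

variable {H : Type*} [NormedAddCommGroup H] [InnerProductSpace ℂ H]

/-- `A` is m-dissipative: `Re ⟨A x, x⟩ ≤ 0` on the domain, and `λ I - A` is onto for all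
`λ > 0`. -/
structure IsMDissipative (A : H →ₗ.[ℂ] H) : Prop where
  dissipative : ∀ x : A.domain, (⟪A x, (x : H)⟫_ℂ).re ≤ 0
  range_eq : ∀ r : ℝ, 0 < r → ∀ y : H, ∃ x : A.domain, (r : ℂ) • (x : H) - A x = y

/-- `(T t)_{t ≥ 0}` is a strongly continuous semigroup of contractions. The values of `T` at
negative times are irrelevant. -/
structure IsContractionSemigroup (T : ℝ → H →L[ℂ] H) : Prop where
  zero : T 0 = ContinuousLinearMap.id ℂ H
  add : ∀ s t : ℝ, 0 ≤ s → 0 ≤ t → T (s + t) = (T s).comp (T t)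
  continuous : ∀ x : H, ContinuousOn (fun t => T t x) (Ici 0)
  contraction : ∀ t : ℝ, 0 ≤ t → ‖T t‖ ≤ 1

/-- `A` is the infinitesimal generator of `(T t)_{t ≥ 0}`: the pair `(x, y)` is in the graph of `A`
if and only if `(T h x - x) / h` tends to `y` as `h → 0+`. -/
def IsGenerator (A : H →ₗ.[ℂ] H) (T : ℝ → H →L[ℂ] H) : Prop :=
  ∀ x y : H, (x, y) ∈ A.graph ↔ Tendsto (fun h : ℝ => h⁻¹ • (T h x - x)) (𝓝[>] 0) (𝓝 y)

/-- `(y, y')` is in the graph of the adjoint of `A`, that is `y ∈ D(A*)` and `A* y = y'`. -/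
def IsAdjointPair (A : H →ₗ.[ℂ] H) (y y' : H) : Prop :=
  ∀ x : A.domain, ⟪y, A x⟫_ℂ = ⟪y', (x : H)⟫_ℂ

/-- Weak solution in `C(ℝ₊, H)` of `Φ' = A Φ`, `Φ(0) = Φ₀`: for every `y ∈ D(A*)` the function
`t ↦ ⟨Φ(t), y⟩` is absolutely continuous with derivative `⟨Φ(t), A* y⟩`, written here in integrated
form. Only the values of `Φ` on `[0, ∞)` matter. -/
structure IsWeakSolution (A : H →ₗ.[ℂ] H) (Φ₀ : H) (Φ : ℝ → H) : Prop where
  continuous : ContinuousOn Φ (Ici 0)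
  initial : Φ 0 = Φ₀
  equation : ∀ y y' : H, IsAdjointPair A y y' → ∀ t : ℝ, 0 ≤ t →
    ⟪y, Φ t⟫_ℂ = ⟪y, Φ₀⟫_ℂ + ∫ s in (0 : ℝ)..t, ⟪y', Φ s⟫_ℂ

/-- Strong solution of `Φ' = A Φ`, `Φ(0) = Φ₀`: for all `t ≥ 0`, `Φ(t) ∈ D(A)` and `Φ` is
differentiable at `t` (from the right at `t = 0`) with derivative `A Φ(t)`. Only the values of `Φ`
on `[0, ∞)` matter. -/
structure IsStrongSolution (A : H →ₗ.[ℂ] H) (Φ₀ : H) (Φ : ℝ → H) : Prop where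
  initial : Φ 0 = Φ₀
  equation : ∀ t : ℝ, 0 ≤ t → ∃ h : Φ t ∈ A.domain, HasDerivWithinAt Φ (A ⟨Φ t, h⟩) (Ici 0) t

/-- `Φ ∈ C(ℝ₊, D(A))`, where `D(A)` carries the graph norm. -/
def ContinuousInDomain (A : H →ₗ.[ℂ] H) (Φ : ℝ → H) : Prop :=
  ∃ Ψ : ℝ → H, (∀ t : ℝ, 0 ≤ t → (Φ t, Ψ t) ∈ A.graph) ∧
    ContinuousOn Φ (Ici 0) ∧ ContinuousOn Ψ (Ici 0)

end Abstract

end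

end CoupledWave

open CoupledWave

namespace CoupledWave

noncomputable section

/-! ### Norm-continuous contraction semigroups -/

section Bounded

variable {H : Type*} [NormedAddCommGroup H] [InnerProductSpace ℂ H] [CompleteSpace H]

/-! Everything after m-dissipativity is Hilbert space semigroup theory. The Yosida approximations
`A_n = r (J_n - I)`, with `r = n + 1` and `J_n = r (r I - A)⁻¹`, are bounded, dissipative and
mutually commuting, and `A_n x = J_n A x → A x` on `D(A)`. Hence the contractions `exp (t A_n)`
converge strongly (`norm_exp_sub_exp_le`, `cauchySeq_exp_yosida`). The limit satisfies `T(t) x = x +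
∫₀ᵗ T(s) A x ds` on `D(A)` (`semigroup_eq_integral`). Strong solutions are read off from this
formula, and weak ones follow by density of the domain.

Uniqueness of strong solutions is the decay of the norm along dissipative trajectories. For weak
solutions, the time integral of the difference of two solutions is a strong solution starting at
zero (`mem_graph_of_adjointPair`, `weakSolution_unique`).

For the wave operator, the gradient terms cancel in the real part of `⟨AΦ, Φ⟩` by Green's formula,
and the coupling terms cancel because `c` is real and enters with opposite signs; only the damping
by `b` and `d` remains (`re_inner_waveOp`). For surjectivity, `v` and `z` are eliminated, and the
resulting elliptic system for `(φ, ψ)` is solved by coercivity (`exists_inner_add_inner_eq`,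
`waveOp_range`). The Poincaré inequality and closedness of the gradient make the energy space
complete. -/

lemma hasDerivAt_exp_smul_apply (B : H →L[ℂ] H) (x : H) (t : ℝ) :
    HasDerivAt (fun u : ℝ => NormedSpace.exp (u • B) x) (NormedSpace.exp (t • B) (B x)) t := by
  have h := hasDerivAt_exp_smul_const (𝕂 := ℝ) B t
  exact (((ContinuousLinearMap.apply ℂ H x).restrictScalars ℝ).hasFDerivAt).comp_hasDerivAt t h

lemma exp_add_smul (B : H →L[ℂ] H) (s t : ℝ) :
    NormedSpace.exp ((s + t) • B) = NormedSpace.exp (s • B) * NormedSpace.exp (t • B) := by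
  let _ : NormedAlgebra ℚ (H →L[ℂ] H) := NormedAlgebra.restrictScalars ℚ ℝ _
  rw [add_smul]
  exact NormedSpace.exp_add_of_commute (((Commute.refl B).smul_left s).smul_right t)

lemma exp_smul_apply_comm {B C : H →L[ℂ] H} (h : Commute C B) (t : ℝ) (x : H) :
    NormedSpace.exp (t • B) (C x) = C (NormedSpace.exp (t • B) x) :=
  (DFunLike.congr_fun (h.smul_right t).exp_right.eq x).symm

lemma hasDerivWithinAt_norm_sq_complex {E : Type*} [NormedAddCommGroup E] [InnerProductSpace ℂ E]
    {u : ℝ → E} {u' : E} {s : Set ℝ} {t : ℝ} (hu : HasDerivWithinAt u u' s t) :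
    HasDerivWithinAt (fun r => ‖u r‖ ^ 2) (2 * (⟪u', u t⟫_ℂ).re) s t := by
  let _ : InnerProductSpace ℝ E := InnerProductSpace.complexToReal
  refine hu.norm_sq.congr_deriv ?_
  rw [real_inner_comm]
  rfl

/-- A trajectory whose velocity makes a nonpositive product with its position has norm at most its
initial norm. -/
lemma norm_le_of_hasDerivWithinAt_dissipative {E : Type*} [NormedAddCommGroup E]
    [InnerProductSpace ℂ E] {u u' : ℝ → E}
    (hu : ∀ t, 0 ≤ t → HasDerivWithinAt u (u' t) (Ici 0) t)
    (hd : ∀ t, 0 ≤ t → (⟪u' t, u t⟫_ℂ).re ≤ 0) {t : ℝ} (ht : 0 ≤ t) : ‖u t‖ ≤ ‖u 0‖ := by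
  have hder := fun s hs => hasDerivWithinAt_norm_sq_complex (hu s hs)
  have hanti : AntitoneOn (fun s => ‖u s‖ ^ 2) (Ici 0) := by
    refine antitoneOn_of_deriv_nonpos (convex_Ici 0)
      (fun s hs => (hder s hs).continuousWithinAt) ?_ ?_
    · intro s hs
      rw [interior_Ici] at hs ⊢
      exact ((hder s (le_of_lt hs)).hasDerivAt
        (Ici_mem_nhds hs)).differentiableAt.differentiableWithinAt
    · intro s hs
      rw [interior_Ici] at hs
      rw [((hder s (le_of_lt hs)).hasDerivAt (Ici_mem_nhds hs)).deriv]
      linarith [hd s (le_of_lt hs)]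
  exact le_of_sq_le_sq (hanti self_mem_Ici ht ht) (norm_nonneg _)

/-- The orbit has velocity `B` applied to itself, so dissipativity makes its norm nonincreasing. -/
lemma norm_exp_smul_apply_le {B : H →L[ℂ] H} (hB : ∀ x, (⟪B x, x⟫_ℂ).re ≤ 0) {t : ℝ} (ht : 0 ≤ t)
    (x : H) : ‖NormedSpace.exp (t • B) x‖ ≤ ‖x‖ := by
  have h := norm_le_of_hasDerivWithinAt_dissipative
    (u := fun s : ℝ => NormedSpace.exp (s • B) x)
    (fun s _ => (hasDerivAt_exp_smul_apply B x s).hasDerivWithinAt)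
    (fun s _ => by
      rw [exp_smul_apply_comm (Commute.refl B)]
      exact hB _) ht
  simpa using h

lemma norm_exp_sub_exp_le {B C : H →L[ℂ] H} (hB : ∀ x, (⟪B x, x⟫_ℂ).re ≤ 0)
    (hC : ∀ x, (⟪C x, x⟫_ℂ).re ≤ 0) (hBC : Commute B C) {t : ℝ} (ht : 0 ≤ t) (x : H) :
    ‖NormedSpace.exp (t • B) x - NormedSpace.exp (t • C) x‖ ≤ t * ‖B x - C x‖ := by
  -- The path `s ↦ exp (sB) exp ((t - s)C) x` joins `exp (tC) x` to `exp (tB) x`. By commutation its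
  -- velocity is two contractions applied to `B x - C x`, so the mean value inequality gives the
  -- bound.
  have hder : ∀ s : ℝ, HasDerivAt
      (fun s : ℝ => (NormedSpace.exp (s • B) * NormedSpace.exp ((t - s) • C)) x)
      (NormedSpace.exp (s • B) (NormedSpace.exp ((t - s) • C) (B x - C x))) s := by
    intro s
    have h1 := hasDerivAt_exp_smul_const (𝕂 := ℝ) B s
    have h2 := (hasDerivAt_exp_smul_const (𝕂 := ℝ) C (t - s)).scomp s
      ((hasDerivAt_id s).const_sub t)
    have h3 := (((ContinuousLinearMap.apply ℂ H x).restrictScalars ℝ).hasFDerivAt).comp_hasDerivAt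
      s (h1.mul h2)
    refine h3.congr_deriv ?_
    change NormedSpace.exp (s • B) (B (NormedSpace.exp ((t - s) • C) x))
      + NormedSpace.exp (s • B) (((-1 : ℝ) • (NormedSpace.exp ((t - s) • C) * C)) x) = _
    rw [← exp_smul_apply_comm hBC, ← map_add, map_sub]
    congr 1
    simp [sub_eq_add_neg]
  have h := (convex_Icc 0 t).norm_image_sub_le_of_norm_hasDerivWithin_le (C := ‖B x - C x‖)
    (fun s _ => (hder s).hasDerivWithinAt)
    (fun s hs => (norm_exp_smul_apply_le hB hs.1 _).trans
      (norm_exp_smul_apply_le hC (sub_nonneg.2 hs.2) _))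
    (left_mem_Icc.2 ht) (right_mem_Icc.2 ht)
  simpa [abs_of_nonneg ht, mul_comm] using h

lemma exp_smul_apply_eq_integral (B : H →L[ℂ] H) (x : H) (t : ℝ) :
    NormedSpace.exp (t • B) x = x + ∫ s in (0 : ℝ)..t, NormedSpace.exp (s • B) (B x) := by
  have hc : Continuous fun s : ℝ => NormedSpace.exp (s • B) (B x) :=
    continuous_iff_continuousAt.2 fun s => (hasDerivAt_exp_smul_apply B (B x) s).continuousAt
  rw [intervalIntegral.integral_eq_sub_of_hasDerivAt
    (fun s _ => hasDerivAt_exp_smul_apply B x s) (hc.intervalIntegrable _ _)]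
  simp

end Bounded

/-! ### Yosida approximation -/

section Yosida

variable {H : Type*} [NormedAddCommGroup H] [InnerProductSpace ℂ H] {A : H →ₗ.[ℂ] H}

namespace IsMDissipative

lemma re_inner_graph (hA : IsMDissipative A) {x y : H} (h : (x, y) ∈ A.graph) :
    (⟪y, x⟫_ℂ).re ≤ 0 := by
  obtain ⟨w, rfl, rfl⟩ := A.mem_graph_iff.1 h
  exact hA.dissipative w

lemma exists_graph (hA : IsMDissipative A) {r : ℝ} (hr : 0 < r) (y : H) :
    ∃ x, (x, (r : ℂ) • x - y) ∈ A.graph := by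
  obtain ⟨x, hx⟩ := hA.range_eq r hr y
  refine ⟨x, ?_⟩
  rw [← hx, sub_sub_cancel]
  exact A.mem_graph x

/-- Pair `r x - A x` with `x`: dissipativity bounds the real part below by `r ‖x‖²`, Cauchy-Schwarz
bounds it above. This gives injectivity of `r I - A` and the resolvent bound. -/
lemma mul_norm_le (hA : IsMDissipative A) {r : ℝ} {x y : H} (h : (x, y) ∈ A.graph) :
    r * ‖x‖ ≤ ‖(r : ℂ) • x - y‖ := by
  rcases eq_or_ne x 0 with rfl | hx
  · simp
  have hpos : 0 < ‖x‖ := norm_pos_iff.2 hx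
  have h1 : r * ‖x‖ ^ 2 ≤ (⟪(r : ℂ) • x - y, x⟫_ℂ).re := by
    rw [inner_sub_left, inner_smul_left, Complex.conj_ofReal, inner_self_eq_norm_sq_to_K,
      Complex.sub_re, Complex.re_ofReal_mul]
    have := hA.re_inner_graph h
    have h2 : (((‖x‖ : ℝ) : ℂ) ^ 2).re = ‖x‖ ^ 2 := by
      rw [← Complex.ofReal_pow, Complex.ofReal_re]
    simp only [Complex.coe_algebraMap]
    rw [h2]
    linarith
  have h3 : (⟪(r : ℂ) • x - y, x⟫_ℂ).re ≤ ‖(r : ℂ) • x - y‖ * ‖x‖ :=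
    (Complex.re_le_norm _).trans (norm_inner_le_norm _ _)
  have h4 : (r * ‖x‖) * ‖x‖ ≤ ‖(r : ℂ) • x - y‖ * ‖x‖ := by
    rw [mul_assoc, ← sq]; exact h1.trans h3
  exact le_of_mul_le_mul_right h4 hpos

lemma graph_unique (hA : IsMDissipative A) {r : ℝ} (hr : 0 < r) {x x' y : H}
    (h : (x, (r : ℂ) • x - y) ∈ A.graph) (h' : (x', (r : ℂ) • x' - y) ∈ A.graph) : x = x' := by
  have h1 := hA.mul_norm_le (r := r) (A.graph.sub_mem h h')
  change r * ‖x - x'‖ ≤ ‖(r : ℂ) • (x - x') - ((r : ℂ) • x - y - ((r : ℂ) • x' - y))‖ at h1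
  have h2 : (r : ℂ) • (x - x') - ((r : ℂ) • x - y - ((r : ℂ) • x' - y)) = 0 := by
    rw [smul_sub]; abel
  rw [h2, norm_zero] at h1
  exact sub_eq_zero.1 (norm_le_zero_iff.1 (nonpos_of_mul_nonpos_right h1 hr))

lemma exists_resolvent (hA : IsMDissipative A) {r : ℝ} (hr : 0 < r) :
    ∃ R : H →L[ℂ] H, ∀ y, (R y, (r : ℂ) • R y - y) ∈ A.graph := by
  choose R hR using fun y => hA.exists_graph hr y
  let L : H →ₗ[ℂ] H :=
    { toFun := R
      map_add' := fun y y' => by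
        refine hA.graph_unique hr (hR _) ?_
        have := A.graph.add_mem (hR y) (hR y')
        rw [Prod.mk_add_mk] at this
        convert this using 2
        rw [smul_add]; abel
      map_smul' := fun k y => by
        refine hA.graph_unique hr (hR _) ?_
        have := A.graph.smul_mem k (hR y)
        rw [Prod.smul_mk, smul_sub, smul_comm] at this
        exact this }
  refine ⟨L.mkContinuous r⁻¹ fun y => ?_, hR⟩
  have h := hA.mul_norm_le (r := r) (hR y)
  rw [sub_sub_cancel] at h
  rwa [← div_eq_inv_mul, le_div_iff₀' hr]

/-- The resolvent `(r I - A)⁻¹`. -/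
def resolvent (hA : IsMDissipative A) {r : ℝ} (hr : 0 < r) : H →L[ℂ] H :=
  (hA.exists_resolvent hr).choose

lemma resolvent_graph (hA : IsMDissipative A) {r : ℝ} (hr : 0 < r) (y : H) :
    (hA.resolvent hr y, (r : ℂ) • hA.resolvent hr y - y) ∈ A.graph :=
  (hA.exists_resolvent hr).choose_spec y

lemma resolvent_apply (hA : IsMDissipative A) {r : ℝ} (hr : 0 < r) {x y : H}
    (h : (x, y) ∈ A.graph) : hA.resolvent hr ((r : ℂ) • x - y) = x :=
  hA.graph_unique hr (hA.resolvent_graph hr _) (by rwa [sub_sub_cancel])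

lemma norm_resolvent_le (hA : IsMDissipative A) {r : ℝ} (hr : 0 < r) (y : H) :
    r * ‖hA.resolvent hr y‖ ≤ ‖y‖ := by
  have h := hA.mul_norm_le (r := r) (hA.resolvent_graph hr y)
  rwa [sub_sub_cancel] at h

/-- The resolvent identity. -/
lemma resolvent_resolvent (hA : IsMDissipative A) {r s : ℝ} (hr : 0 < r) (hs : 0 < s) (y : H) :
    ((r : ℂ) - s) • hA.resolvent hr (hA.resolvent hs y)
      = hA.resolvent hs y - hA.resolvent hr y := by
  have h := hA.resolvent_apply hr (hA.resolvent_graph hs y)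
  rw [map_sub, map_sub, map_smul, map_smul] at h
  nth_rewrite 2 [← h]
  rw [sub_smul]
  abel

/-- The resolvent identity, read with `r` and `s` in both orders, gives the same value for both
composites multiplied by `r - s`; the case `r = s` is trivial. -/
lemma commute_resolvent (hA : IsMDissipative A) {r s : ℝ} (hr : 0 < r) (hs : 0 < s) :
    Commute (hA.resolvent hr) (hA.resolvent hs) := by
  rcases eq_or_ne r s with rfl | hne
  · exact Commute.refl _
  ext y
  have h1 := hA.resolvent_resolvent hr hs y
  have h2 := hA.resolvent_resolvent hs hr y
  have hne' : (r : ℂ) - s ≠ 0 := sub_ne_zero.2 (by exact_mod_cast hne)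
  refine smul_right_injective H hne' ?_
  change ((r : ℂ) - s) • hA.resolvent hr (hA.resolvent hs y)
    = ((r : ℂ) - s) • hA.resolvent hs (hA.resolvent hr y)
  rw [h1, ← neg_sub (s : ℂ), neg_smul, h2, neg_sub]

/-- A trajectory of `u' = A u` starting at the origin vanishes. -/
lemma eq_zero_of_hasDerivWithinAt (hA : IsMDissipative A) {u u' : ℝ → H} (h0 : u 0 = 0)
    (hg : ∀ t, 0 ≤ t → (u t, u' t) ∈ A.graph)
    (hu : ∀ t, 0 ≤ t → HasDerivWithinAt u (u' t) (Ici 0) t) {t : ℝ} (ht : 0 ≤ t) : u t = 0 := by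
  have h := norm_le_of_hasDerivWithinAt_dissipative hu (fun s hs => hA.re_inner_graph (hg s hs)) ht
  rw [h0, norm_zero] at h
  exact norm_le_zero_iff.1 h

/-- Strong solutions are unique. -/
lemma strongSolution_unique (hA : IsMDissipative A) {x : H} {Φ Ψ : ℝ → H}
    (hΦ : IsStrongSolution A x Φ) (hΨ : IsStrongSolution A x Ψ) {t : ℝ} (ht : 0 ≤ t) :
    Φ t = Ψ t := by
  -- The velocity of the difference must be a function on all of `ℝ`; its value at negative times is
  -- the dummy `0`.
  have h1 : ∀ s, ∃ y, 0 ≤ s → (Φ s - Ψ s, y) ∈ A.graph ∧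
      HasDerivWithinAt (fun r => Φ r - Ψ r) y (Ici 0) s := by
    intro s
    by_cases hs : 0 ≤ s
    · obtain ⟨p, hp⟩ := hΦ.equation s hs
      obtain ⟨q, hq⟩ := hΨ.equation s hs
      exact ⟨_, fun _ => ⟨A.graph.sub_mem (A.mem_graph ⟨_, p⟩) (A.mem_graph ⟨_, q⟩), hp.sub hq⟩⟩
    · exact ⟨0, fun h => absurd h hs⟩
  choose y hy using h1
  refine sub_eq_zero.1 (hA.eq_zero_of_hasDerivWithinAt (u := fun r => Φ r - Ψ r) (u' := y) ?_
    (fun s hs => (hy s hs).1) (fun s hs => (hy s hs).2) ht)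
  rw [hΦ.initial, hΨ.initial, sub_self]

/-- A vector is in the graph if it satisfies the equation tested against all adjoint pairs. -/
lemma mem_graph_of_adjointPair [CompleteSpace H] (hA : IsMDissipative A) {w u : H}
    (h : ∀ y y' : H, IsAdjointPair A y y' → ⟪y, u⟫_ℂ = ⟪y', w⟫_ℂ) : (w, u) ∈ A.graph := by
  -- With `R = (I - A)⁻¹`, the vector `R* k` lies in the domain of the adjoint and `A* R* k = R* k -
  -- k`. Testing against these pairs already yields `R (w - u) = w`, which says `A w = u`.
  have hpair : ∀ k : H, IsAdjointPair A ((hA.resolvent one_pos).adjoint k)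
      ((hA.resolvent one_pos).adjoint k - k) := by
    intro k x
    have hx := hA.resolvent_apply one_pos (A.mem_graph x)
    rw [Complex.ofReal_one, one_smul, map_sub] at hx
    rw [inner_sub_left, ContinuousLinearMap.adjoint_inner_left,
      ContinuousLinearMap.adjoint_inner_left, ← inner_sub_right]
    rw [show hA.resolvent one_pos (A x) = hA.resolvent one_pos (x : H) - x by
      rw [eq_sub_iff_add_eq', eq_comm, ← sub_eq_iff_eq_add, hx]]
  have hres : hA.resolvent one_pos (w - u) = w := by
    refine ext_inner_left ℂ fun k => ?_
    have := h _ _ (hpair k)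
    rw [inner_sub_left, ContinuousLinearMap.adjoint_inner_left,
      ContinuousLinearMap.adjoint_inner_left] at this
    rw [map_sub, inner_sub_right, this]
    abel
  have hg := hA.resolvent_graph one_pos (w - u)
  rwa [hres, Complex.ofReal_one, one_smul, sub_sub_cancel] at hg

/-- The domain of an m-dissipative operator in a Hilbert space is dense. -/
lemma dense_domain [CompleteSpace H] (hA : IsMDissipative A) : Dense (A.domain : Set H) := by
  rw [Submodule.dense_iff_topologicalClosure_eq_top, Submodule.topologicalClosure_eq_top_iff,
    Submodule.eq_bot_iff]
  intro y hy
  -- For `y` orthogonal to the domain and `x = (I - A)⁻¹ y`, one has `Re ⟨A x, x⟩ = ‖x‖² - Re ⟨y, x⟩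
  -- = ‖x‖²`. Dissipativity forces `x = 0`, hence `y = 0`.
  have hg := hA.resolvent_graph one_pos y
  have hm := A.mem_domain_of_mem_graph hg
  have h0 := (Submodule.mem_orthogonal _ _).1 hy _ hm
  have h1 := hA.re_inner_graph hg
  rw [inner_sub_left, inner_smul_left, Complex.conj_ofReal, Complex.ofReal_one, one_mul,
    ← inner_conj_symm y, h0, map_zero, sub_zero, inner_self_eq_norm_sq_to_K] at h1
  have h2 : ‖hA.resolvent one_pos y‖ ^ 2 ≤ 0 := by
    simp only [Complex.coe_algebraMap] at h1
    rwa [← Complex.ofReal_pow, Complex.ofReal_re] at h1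
  have h3 : hA.resolvent one_pos y = 0 :=
    norm_eq_zero.1 (pow_eq_zero_iff two_ne_zero |>.1 (le_antisymm h2 (sq_nonneg _)))
  rw [h3, smul_zero, zero_sub] at hg
  simpa using A.graph_fst_eq_zero_snd hg rfl

/-- The contraction `J = r (r I - A)⁻¹` for `r = n + 1`. -/
def smoothing (hA : IsMDissipative A) (n : ℕ) : H →L[ℂ] H :=
  ((n + 1 : ℝ) : ℂ) • hA.resolvent (r := n + 1) n.cast_add_one_pos

/-- The Yosida approximation `r (J - I)` of `A`, for `r = n + 1`. -/
def yosida (hA : IsMDissipative A) (n : ℕ) : H →L[ℂ] H :=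
  ((n + 1 : ℝ) : ℂ) • (hA.smoothing n - 1)

lemma norm_smoothing_le (hA : IsMDissipative A) (n : ℕ) (x : H) : ‖hA.smoothing n x‖ ≤ ‖x‖ := by
  have h := hA.norm_resolvent_le (r := n + 1) n.cast_add_one_pos x
  rw [smoothing, smul_apply, norm_smul, Complex.norm_real,
    Real.norm_of_nonneg n.cast_add_one_pos.le]
  exact h

lemma commute_yosida (hA : IsMDissipative A) (n k : ℕ) :
    Commute (hA.yosida n) (hA.yosida k) := by
  have h := hA.commute_resolvent (r := n + 1) (s := k + 1) n.cast_add_one_pos k.cast_add_one_pos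
  have h1 : Commute (hA.smoothing n) (hA.smoothing k) := (h.smul_left _).smul_right _
  exact (((h1.sub_left (Commute.one_left _)).sub_right (Commute.one_right _)).smul_left
    _).smul_right _

/-- Since `J` is a contraction, `Re ⟨J x, x⟩ ≤ ‖x‖²`. -/
lemma yosida_dissipative (hA : IsMDissipative A) (n : ℕ) (x : H) :
    (⟪hA.yosida n x, x⟫_ℂ).re ≤ 0 := by
  have h1 : (⟪hA.smoothing n x, x⟫_ℂ).re ≤ ‖x‖ ^ 2 :=
    (Complex.re_le_norm _).trans ((norm_inner_le_norm _ _).trans (by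
      rw [sq]; exact mul_le_mul_of_nonneg_right (hA.norm_smoothing_le n x) (norm_nonneg _)))
  have h2 : (⟪x, x⟫_ℂ).re = ‖x‖ ^ 2 := by
    exact inner_self_eq_norm_sq (𝕜 := ℂ) x
  rw [yosida, smul_apply, inner_smul_left, Complex.conj_ofReal,
    Complex.re_ofReal_mul, sub_apply, one_apply_eq_self,
    inner_sub_left, Complex.sub_re, h2]
  exact mul_nonpos_of_nonneg_of_nonpos n.cast_add_one_pos.le (by linarith)

lemma smoothing_sub_eq (hA : IsMDissipative A) (n : ℕ) {x y : H} (h : (x, y) ∈ A.graph) :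
    hA.smoothing n x - x = hA.resolvent (r := n + 1) n.cast_add_one_pos y := by
  have h1 := hA.resolvent_apply (r := n + 1) n.cast_add_one_pos h
  rw [map_sub, map_smul] at h1
  nth_rewrite 2 [← h1]
  rw [smoothing, smul_apply]
  abel

lemma yosida_apply (hA : IsMDissipative A) (n : ℕ) {x y : H} (h : (x, y) ∈ A.graph) :
    hA.yosida n x = hA.smoothing n y := by
  rw [yosida, smul_apply, sub_apply,
    one_apply_eq_self, hA.smoothing_sub_eq n h]
  rfl

/-- On the domain `J w - w = (r I - A)⁻¹ A w` has norm at most `‖A w‖ / r`. Density and the uniform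
bound on `J` extend the convergence to every vector. -/
lemma tendsto_smoothing [CompleteSpace H] (hA : IsMDissipative A) (x : H) :
    Tendsto (fun n => hA.smoothing n x) atTop (𝓝 x) := by
  rw [Metric.tendsto_atTop]
  intro ε hε
  obtain ⟨w, hw, hxw⟩ := Metric.dense_iff.1 hA.dense_domain x (ε / 3) (by positivity)
  obtain ⟨y, hy⟩ := A.mem_domain_iff.1 hxw
  obtain ⟨n₀, hn₀⟩ := exists_nat_gt (‖y‖ / (ε / 3))
  refine ⟨n₀, fun n hn => ?_⟩
  have hb : ‖hA.smoothing n w - w‖ ≤ ε / 3 := by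
    have hpos : (0 : ℝ) < n + 1 := n.cast_add_one_pos
    rw [hA.smoothing_sub_eq n hy, ← mul_le_mul_iff_right₀ hpos]
    refine (hA.norm_resolvent_le hpos y).trans ?_
    have : (n₀ : ℝ) ≤ n + 1 := by
      have : (n₀ : ℝ) ≤ n := by exact_mod_cast hn
      linarith
    exact ((div_lt_iff₀ (by positivity)).1 (hn₀.trans_le this)).le
  have hw' : ‖w - x‖ < ε / 3 := by simpa [dist_eq_norm] using hw
  have h1 : ‖hA.smoothing n (x - w)‖ < ε / 3 :=
    (hA.norm_smoothing_le n _).trans_lt (by rwa [norm_sub_rev])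
  have : hA.smoothing n x - x = hA.smoothing n (x - w) + (hA.smoothing n w - w) + (w - x) := by
    rw [map_sub]; abel
  rw [dist_eq_norm, this]
  calc _ ≤ ‖hA.smoothing n (x - w)‖ + ‖hA.smoothing n w - w‖ + ‖w - x‖ := norm_add₃_le
    _ < ε := by linarith

lemma tendsto_yosida [CompleteSpace H] (hA : IsMDissipative A) {x y : H} (h : (x, y) ∈ A.graph) :
    Tendsto (fun n => hA.yosida n x) atTop (𝓝 y) := by
  simpa only [hA.yosida_apply _ h] using hA.tendsto_smoothing y

end IsMDissipative

end Yosida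

/-! ### The semigroup generated by an m-dissipative operator -/

section Semigroup

variable {H : Type*} [NormedAddCommGroup H] [InnerProductSpace ℂ H] [CompleteSpace H]
  {A : H →ₗ.[ℂ] H}

namespace IsMDissipative

lemma norm_exp_yosida_le (hA : IsMDissipative A) (n : ℕ) {t : ℝ} (ht : 0 ≤ t) (x : H) :
    ‖NormedSpace.exp (t • hA.yosida n) x‖ ≤ ‖x‖ :=
  norm_exp_smul_apply_le (hA.yosida_dissipative n) ht x

/-- Two approximate orbits differ by at most `t ‖A_n x - A_k x‖`, and `A_n x` converges for `x` in
the domain. -/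
lemma cauchySeq_exp_yosida_of_graph (hA : IsMDissipative A) {t : ℝ} (ht : 0 ≤ t) {x y : H}
    (h : (x, y) ∈ A.graph) : CauchySeq fun n => NormedSpace.exp (t • hA.yosida n) x := by
  rw [Metric.cauchySeq_iff]
  intro ε hε
  obtain ⟨n₀, hn₀⟩ := Metric.cauchySeq_iff.1 (hA.tendsto_yosida h).cauchySeq (ε / (t + 1))
    (by positivity)
  refine ⟨n₀, fun n hn k hk => ?_⟩
  have h1 := norm_exp_sub_exp_le (hA.yosida_dissipative n) (hA.yosida_dissipative k)
    (hA.commute_yosida n k) ht x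
  have h2 := hn₀ n hn k hk
  rw [dist_eq_norm, lt_div_iff₀ (by positivity)] at h2
  rw [dist_eq_norm]
  refine h1.trans_lt (lt_of_le_of_lt ?_ h2)
  rw [mul_comm]
  exact mul_le_mul_of_nonneg_left (by linarith) (norm_nonneg _)

lemma cauchySeq_exp_yosida (hA : IsMDissipative A) {t : ℝ} (ht : 0 ≤ t) (x : H) :
    CauchySeq fun n => NormedSpace.exp (t • hA.yosida n) x := by
  rw [Metric.cauchySeq_iff]
  intro ε hε
  obtain ⟨w, hw, hxw⟩ := Metric.dense_iff.1 hA.dense_domain x (ε / 3) (by positivity)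
  obtain ⟨y, hy⟩ := A.mem_domain_iff.1 hxw
  obtain ⟨n₀, hn₀⟩ := Metric.cauchySeq_iff.1 (hA.cauchySeq_exp_yosida_of_graph ht hy) (ε / 3)
    (by positivity)
  refine ⟨n₀, fun n hn k hk => ?_⟩
  have hw' : ‖x - w‖ < ε / 3 := by rw [norm_sub_rev]; simpa [dist_eq_norm] using hw
  have h1 := hn₀ n hn k hk
  have h2 : ∀ j, dist (NormedSpace.exp (t • hA.yosida j) x) (NormedSpace.exp (t • hA.yosida j) w)
      < ε / 3 := fun j => by
    rw [dist_eq_norm, ← map_sub]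
    exact (hA.norm_exp_yosida_le j ht _).trans_lt hw'
  have h3 := h2 k
  rw [dist_comm] at h3
  calc _ ≤ _ := dist_triangle4 _ (NormedSpace.exp (t • hA.yosida n) w)
        (NormedSpace.exp (t • hA.yosida k) w) _
    _ < ε := by linarith [h2 n]

lemma exists_semigroup (hA : IsMDissipative A) (t : ℝ) : ∃ S : H →L[ℂ] H, ∀ x,
    Tendsto (fun n => NormedSpace.exp (max t 0 • hA.yosida n) x) atTop (𝓝 (S x)) := by
  choose f hf using fun x => cauchySeq_tendsto_of_complete
    (hA.cauchySeq_exp_yosida (le_max_right t 0) x)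
  -- The pointwise limit of bounded operators is bounded by Banach-Steinhaus. Clamping `t` at zero
  -- makes the limit exist for every real `t`, and makes orbits continuous on the whole line.
  exact ⟨continuousLinearMapOfTendsto (fun n => NormedSpace.exp (max t 0 • hA.yosida n))
    (tendsto_pi_nhds.2 hf), hf⟩

/-- The semigroup generated by `A`, extended by the identity to negative times. -/
def semigroup (hA : IsMDissipative A) (t : ℝ) : H →L[ℂ] H := (hA.exists_semigroup t).choose

lemma tendsto_semigroup (hA : IsMDissipative A) {t : ℝ} (ht : 0 ≤ t) (x : H) :
    Tendsto (fun n => NormedSpace.exp (t • hA.yosida n) x) atTop (𝓝 (hA.semigroup t x)) := by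
  have h := (hA.exists_semigroup t).choose_spec x
  change Tendsto _ _ (𝓝 (hA.semigroup t x)) at h
  rwa [max_eq_left ht] at h

lemma semigroup_of_nonpos (hA : IsMDissipative A) {t : ℝ} (ht : t ≤ 0) (x : H) :
    hA.semigroup t x = x := by
  have h := (hA.exists_semigroup t).choose_spec x
  change Tendsto _ _ (𝓝 (hA.semigroup t x)) at h
  rw [max_eq_right ht] at h
  refine tendsto_nhds_unique h ?_
  simp

lemma norm_semigroup_le (hA : IsMDissipative A) (t : ℝ) (x : H) : ‖hA.semigroup t x‖ ≤ ‖x‖ := by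
  rcases le_total 0 t with ht | ht
  · exact le_of_tendsto (hA.tendsto_semigroup ht x).norm
      (Eventually.of_forall fun n => hA.norm_exp_yosida_le n ht x)
  · rw [hA.semigroup_of_nonpos ht]

lemma semigroup_add (hA : IsMDissipative A) {s t : ℝ} (hs : 0 ≤ s) (ht : 0 ≤ t) (x : H) :
    hA.semigroup (s + t) x = hA.semigroup s (hA.semigroup t x) := by
  refine tendsto_nhds_unique (hA.tendsto_semigroup (add_nonneg hs ht) x) ?_
  -- Strong convergence passes to the product: the error of the inner factor is not enlarged by the
  -- outer contraction.
  have h0 : Tendsto (fun n => NormedSpace.exp (s • hA.yosida n)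
      (NormedSpace.exp (t • hA.yosida n) x - hA.semigroup t x)) atTop (𝓝 0) :=
    squeeze_zero_norm (fun n => hA.norm_exp_yosida_le n hs _)
      (tendsto_iff_norm_sub_tendsto_zero.1 (hA.tendsto_semigroup ht x))
  have h1 := h0.add (hA.tendsto_semigroup hs (hA.semigroup t x))
  rw [zero_add] at h1
  refine h1.congr fun n => ?_
  rw [← map_add, sub_add_cancel, exp_add_smul]
  rfl

/-- `T(t) x = x + ∫₀ᵗ T(s) A x ds` for `x ∈ D(A)`. -/
lemma semigroup_eq_integral (hA : IsMDissipative A) {x y : H} (h : (x, y) ∈ A.graph) {t : ℝ}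
    (ht : 0 ≤ t) : hA.semigroup t x = x + ∫ s in (0 : ℝ)..t, hA.semigroup s y := by
  refine tendsto_nhds_unique (hA.tendsto_semigroup ht x) ?_
  refine (Tendsto.congr (fun n => (exp_smul_apply_eq_integral (hA.yosida n) x t).symm) ?_)
  refine tendsto_const_nhds.add ?_
  refine intervalIntegral.tendsto_integral_filter_of_dominated_convergence (fun _ => ‖y‖)
    ?_ ?_ intervalIntegrable_const ?_
  · refine Eventually.of_forall fun n => Continuous.aestronglyMeasurable ?_
    exact continuous_iff_continuousAt.2 fun s =>
      (hasDerivAt_exp_smul_apply (hA.yosida n) _ s).continuousAt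
  · refine Eventually.of_forall fun n => Eventually.of_forall fun s hs => ?_
    rw [uIoc_of_le ht] at hs
    refine (hA.norm_exp_yosida_le n hs.1.le _).trans ?_
    rw [hA.yosida_apply n h]
    exact hA.norm_smoothing_le n y
  · refine Eventually.of_forall fun s hs => ?_
    rw [uIoc_of_le ht] at hs
    have h0 : Tendsto (fun n => NormedSpace.exp (s • hA.yosida n) (hA.yosida n x - y))
        atTop (𝓝 0) :=
      squeeze_zero_norm (fun n => hA.norm_exp_yosida_le n hs.1.le _)
        (tendsto_iff_norm_sub_tendsto_zero.1 (hA.tendsto_yosida h))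
    have h1 := h0.add (hA.tendsto_semigroup hs.1.le y)
    rw [zero_add] at h1
    refine h1.congr fun n => ?_
    rw [← map_add, sub_add_cancel]

lemma norm_semigroup_sub_le (hA : IsMDissipative A) {x y : H} (h : (x, y) ∈ A.graph) {t : ℝ}
    (ht : 0 ≤ t) : ‖hA.semigroup t x - x‖ ≤ ‖y‖ * t := by
  rw [hA.semigroup_eq_integral h ht, add_sub_cancel_left]
  have := intervalIntegral.norm_integral_le_of_norm_le_const (a := 0) (b := t)
    (f := fun s => hA.semigroup s y) (C := ‖y‖) fun s _ => hA.norm_semigroup_le s y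
  rwa [sub_zero, abs_of_nonneg ht] at this

lemma norm_semigroup_sub_semigroup_le (hA : IsMDissipative A) {x y : H} (h : (x, y) ∈ A.graph)
    (s t : ℝ) : ‖hA.semigroup t x - hA.semigroup s x‖ ≤ ‖y‖ * |t - s| := by
  wlog hst : s ≤ t generalizing s t
  · rw [norm_sub_rev, abs_sub_comm]
    exact this t s (le_of_not_ge hst)
  rw [abs_of_nonneg (sub_nonneg.2 hst)]
  rcases le_total s 0 with hs | hs
  · rcases le_total t 0 with ht | ht
    · rw [hA.semigroup_of_nonpos ht, hA.semigroup_of_nonpos hs, sub_self, norm_zero]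
      exact mul_nonneg (norm_nonneg _) (sub_nonneg.2 hst)
    · rw [hA.semigroup_of_nonpos hs]
      exact (hA.norm_semigroup_sub_le h ht).trans
        (mul_le_mul_of_nonneg_left (by linarith) (norm_nonneg _))
  · have := hA.semigroup_add hs (sub_nonneg.2 hst) x
    rw [add_sub_cancel] at this
    rw [this, ← map_sub]
    exact (hA.norm_semigroup_le _ _).trans (hA.norm_semigroup_sub_le h (sub_nonneg.2 hst))

/-- Orbits starting in the dense domain are Lipschitz, and contractivity makes them approximate
every orbit uniformly in time. -/
lemma continuous_semigroup (hA : IsMDissipative A) (x : H) :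
    Continuous fun t => hA.semigroup t x := by
  refine continuous_of_uniform_approx_of_continuous fun V hV => ?_
  obtain ⟨ε, hε, hV⟩ := Metric.mem_uniformity_dist.1 hV
  obtain ⟨w, hw, hxw⟩ := Metric.dense_iff.1 hA.dense_domain x ε hε
  obtain ⟨y, hy⟩ := A.mem_domain_iff.1 hxw
  refine ⟨fun t => hA.semigroup t w, ?_, fun t => hV ?_⟩
  · refine (LipschitzWith.of_dist_le_mul (K := ‖y‖₊) fun t s => ?_).continuous
    rw [dist_eq_norm, Real.dist_eq]
    exact hA.norm_semigroup_sub_semigroup_le hy s t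
  · rw [dist_eq_norm, ← map_sub]
    exact (hA.norm_semigroup_le t _).trans_lt (by
      rw [norm_sub_rev]; simpa [dist_eq_norm] using hw)

lemma isContractionSemigroup (hA : IsMDissipative A) : IsContractionSemigroup hA.semigroup where
  zero := by
    ext x
    exact hA.semigroup_of_nonpos le_rfl x
  add s t hs ht := by
    ext x
    exact hA.semigroup_add hs ht x
  continuous x := (hA.continuous_semigroup x).continuousOn
  contraction t _ := ContinuousLinearMap.opNorm_le_bound _ zero_le_one fun x => by
    rw [one_mul]; exact hA.norm_semigroup_le t x

/-! ### The infinitesimal generator -/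

lemma tendsto_slope_semigroup (hA : IsMDissipative A) {x y : H} (h : (x, y) ∈ A.graph) :
    Tendsto (fun r : ℝ => r⁻¹ • (hA.semigroup r x - x)) (𝓝[>] 0) (𝓝 y) := by
  have h1 := ((hA.continuous_semigroup y).integral_hasStrictDerivAt 0 0).hasDerivAt
  rw [hA.semigroup_of_nonpos le_rfl] at h1
  have h2 := (hasDerivWithinAt_iff_tendsto_slope' (notMem_Ioi.2 le_rfl)).1
    (h1.hasDerivWithinAt (s := Ioi 0))
  refine h2.congr' ?_
  filter_upwards [self_mem_nhdsWithin] with r hr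
  rw [slope_def_module, hA.semigroup_eq_integral h (le_of_lt hr)]
  simp

lemma isGenerator (hA : IsMDissipative A) : IsGenerator A hA.semigroup := by
  intro x y
  refine ⟨hA.tendsto_slope_semigroup, fun h => ?_⟩
  -- Maximality: choose `x'` in the domain with `x' - A x' = x - y`. Then `w = x - x'` has
  -- difference quotients tending to `w` itself, whereas contractivity makes their limit pair with
  -- `w` to a nonpositive real part; so `w = 0`.
  have hg := hA.resolvent_graph one_pos (x - y)
  rw [Complex.ofReal_one, one_smul] at hg
  set x' := hA.resolvent one_pos (x - y) with hx'
  have h1 := h.sub (hA.tendsto_slope_semigroup hg)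
  have h2 : Tendsto (fun r : ℝ => r⁻¹ • (hA.semigroup r (x - x') - (x - x'))) (𝓝[>] 0)
      (𝓝 (x - x')) := by
    have e : y - (x' - (x - y)) = x - x' := by abel
    rw [e] at h1
    refine h1.congr fun r => ?_
    rw [map_sub, ← smul_sub]
    congr 1
    abel
  set w := x - x' with hw
  have h3 : ∀ᶠ r : ℝ in 𝓝[>] 0, (⟪r⁻¹ • (hA.semigroup r w - w), w⟫_ℂ).re ≤ 0 := by
    filter_upwards [self_mem_nhdsWithin] with r hr
    have e : ⟪r⁻¹ • (hA.semigroup r w - w), w⟫_ℂ = ((r⁻¹ : ℝ) : ℂ) * ⟪hA.semigroup r w - w, w⟫_ℂ := by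
      rw [← Complex.coe_smul, inner_smul_left, Complex.conj_ofReal]
    rw [e, Complex.re_ofReal_mul, inner_sub_left, Complex.sub_re]
    refine mul_nonpos_of_nonneg_of_nonpos (inv_nonneg.2 (le_of_lt hr)) ?_
    have e1 : (⟪w, w⟫_ℂ).re = ‖w‖ ^ 2 := inner_self_eq_norm_sq (𝕜 := ℂ) w
    have e2 : (⟪hA.semigroup r w, w⟫_ℂ).re ≤ ‖w‖ ^ 2 :=
      (Complex.re_le_norm _).trans ((norm_inner_le_norm _ _).trans (by
        rw [sq]; exact mul_le_mul_of_nonneg_right (hA.norm_semigroup_le r w) (norm_nonneg _)))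
    linarith
  have h4 : Tendsto (fun r : ℝ => (⟪r⁻¹ • (hA.semigroup r w - w), w⟫_ℂ).re) (𝓝[>] 0)
      (𝓝 (⟪w, w⟫_ℂ).re) :=
    (Complex.continuous_re.tendsto _).comp (h2.inner tendsto_const_nhds)
  have h5 := le_of_tendsto h4 h3
  have h6 : w = 0 := by
    have e1 : (⟪w, w⟫_ℂ).re = ‖w‖ ^ 2 := inner_self_eq_norm_sq (𝕜 := ℂ) w
    rw [e1] at h5
    exact norm_eq_zero.1 (pow_eq_zero_iff two_ne_zero |>.1 (le_antisymm h5 (sq_nonneg _)))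
  have h7 : x' = x := (sub_eq_zero.1 h6).symm
  rwa [h7, sub_sub_cancel] at hg

/-- `T(t)` commutes with the difference quotients at zero, so the characterization of the generator
applies to `T(t) x`. -/
lemma semigroup_graph (hA : IsMDissipative A) {x y : H} (h : (x, y) ∈ A.graph) {t : ℝ}
    (ht : 0 ≤ t) : (hA.semigroup t x, hA.semigroup t y) ∈ A.graph := by
  rw [hA.isGenerator]
  refine (((hA.semigroup t).continuous.tendsto _).comp (hA.tendsto_slope_semigroup h)).congr' ?_
  filter_upwards [self_mem_nhdsWithin] with r hr
  have hr' : 0 ≤ r := le_of_lt hr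
  rw [Function.comp_apply, ← Complex.coe_smul, map_smul, map_sub, ← hA.semigroup_add ht hr',
    ← hA.semigroup_add hr' ht, add_comm, Complex.coe_smul]

/-! ### Solutions of the Cauchy problem -/

lemma isStrongSolution_semigroup (hA : IsMDissipative A) {x y : H} (h : (x, y) ∈ A.graph) :
    IsStrongSolution A x (fun t => hA.semigroup t x) where
  initial := hA.semigroup_of_nonpos le_rfl x
  equation t ht := by
    have hg := hA.semigroup_graph h ht
    refine ⟨A.mem_domain_of_mem_graph hg, ?_⟩
    have e : A ⟨_, A.mem_domain_of_mem_graph hg⟩ = hA.semigroup t y :=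
      ((A.image_iff (A.mem_domain_of_mem_graph hg)).2 hg).symm
    rw [e]
    refine HasDerivWithinAt.congr ?_ (fun s hs => hA.semigroup_eq_integral h hs)
      (hA.semigroup_eq_integral h ht)
    exact (((hA.continuous_semigroup y).integral_hasStrictDerivAt 0
      t).hasDerivAt.const_add x).hasDerivWithinAt

/-- The orbit, extended by a constant, may have a corner at zero; the primitive `x + ∫₀ᵗ T(s) A x
ds` is `C¹` on the whole line and agrees with it for `t ≥ 0`. -/
lemma contDiffOn_semigroup (hA : IsMDissipative A) {x y : H} (h : (x, y) ∈ A.graph) :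
    ContDiffOn ℝ 1 (fun t => hA.semigroup t x) (Ici 0) := by
  have h1 : ∀ t, HasDerivAt (fun t => x + ∫ s in (0 : ℝ)..t, hA.semigroup s y)
      (hA.semigroup t y) t := fun t =>
    ((hA.continuous_semigroup y).integral_hasStrictDerivAt 0 t).hasDerivAt.const_add x
  have h2 : ContDiff ℝ 1 (fun t => x + ∫ s in (0 : ℝ)..t, hA.semigroup s y) := by
    rw [contDiff_one_iff_deriv]
    refine ⟨fun t => (h1 t).differentiableAt, ?_⟩
    rw [funext fun t => (h1 t).deriv]
    exact hA.continuous_semigroup y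
  exact h2.contDiffOn.congr fun t ht => hA.semigroup_eq_integral h ht

lemma continuousInDomain_semigroup (hA : IsMDissipative A) {x y : H} (h : (x, y) ∈ A.graph) :
    ContinuousInDomain A (fun t => hA.semigroup t x) :=
  ⟨fun t => hA.semigroup t y, fun _ ht => hA.semigroup_graph h ht,
    (hA.continuous_semigroup x).continuousOn, (hA.continuous_semigroup y).continuousOn⟩

/-- For initial data in the domain, pair the integral formula with `y` and move `A` onto `y`. Both
sides are continuous along `J_n x → x`, and `J_n x` lies in the domain. -/
lemma isWeakSolution_semigroup (hA : IsMDissipative A) (x : H) :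
    IsWeakSolution A x (fun t => hA.semigroup t x) where
  continuous := (hA.continuous_semigroup x).continuousOn
  initial := hA.semigroup_of_nonpos le_rfl x
  equation y y' hy t ht := by
    have hcont : ∀ w : H, Continuous fun s => ⟪y', hA.semigroup s w⟫_ℂ := fun w =>
      continuous_const.inner (hA.continuous_semigroup w)
    have hreg : ∀ w ∈ A.domain, ⟪y, hA.semigroup t w⟫_ℂ
        = ⟪y, w⟫_ℂ + ∫ s in (0 : ℝ)..t, ⟪y', hA.semigroup s w⟫_ℂ := by
      intro w hw
      obtain ⟨z, hz⟩ := A.mem_domain_iff.1 hw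
      rw [hA.semigroup_eq_integral hz ht, inner_add_right]
      congr 1
      have e := ((innerSL ℂ y).intervalIntegral_comp_comm
        ((hA.continuous_semigroup z).intervalIntegrable (μ := volume) 0 t)).symm
      refine e.trans (intervalIntegral.integral_congr fun s hs => ?_)
      rw [uIcc_of_le ht] at hs
      obtain ⟨q, hq, hq'⟩ := A.mem_graph_iff.1 (hA.semigroup_graph hz hs.1)
      have := hy q
      rw [hq, hq'] at this
      exact this
    let L : H → ℂ := fun w => ⟪y, w⟫_ℂ + ∫ s in (0 : ℝ)..t, ⟪y', hA.semigroup s w⟫_ℂ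
    have hlim : Tendsto (fun n => L (hA.smoothing n x)) atTop (𝓝 (L x)) := by
      refine (tendsto_const_nhds.inner (hA.tendsto_smoothing x)).add ?_
      refine intervalIntegral.tendsto_integral_filter_of_dominated_convergence
        (fun _ => ‖y'‖ * ‖x‖) ?_ ?_ intervalIntegrable_const ?_
      · exact Eventually.of_forall fun n => (hcont _).aestronglyMeasurable
      · exact Eventually.of_forall fun n => Eventually.of_forall fun s _ =>
          (norm_inner_le_norm _ _).trans (mul_le_mul_of_nonneg_left
            ((hA.norm_semigroup_le s _).trans (hA.norm_smoothing_le n x)) (norm_nonneg _))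
      · exact Eventually.of_forall fun s _ => tendsto_const_nhds.inner
          (((hA.semigroup s).continuous.tendsto x).comp (hA.tendsto_smoothing x))
    have hlim' : Tendsto (fun n => ⟪y, hA.semigroup t (hA.smoothing n x)⟫_ℂ) atTop
        (𝓝 ⟪y, hA.semigroup t x⟫_ℂ) :=
      tendsto_const_nhds.inner
        (((hA.semigroup t).continuous.tendsto x).comp (hA.tendsto_smoothing x))
    refine tendsto_nhds_unique hlim' (hlim.congr fun n => (hreg _ ?_).symm)
    exact A.domain.smul_mem _ (A.mem_domain_of_mem_graph
      (hA.resolvent_graph (r := n + 1) n.cast_add_one_pos x))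

/-- Weak solutions are unique. -/
lemma weakSolution_unique (hA : IsMDissipative A) {x : H} {Φ Ψ : ℝ → H}
    (hΦ : IsWeakSolution A x Φ) (hΨ : IsWeakSolution A x Ψ) {t : ℝ} (ht : 0 ≤ t) :
    Φ t = Ψ t := by
  -- Clamping time makes the difference continuous on `ℝ`, so its primitive is differentiable at
  -- every point, including zero.
  set v : ℝ → H := fun s => Φ (max s 0) - Ψ (max s 0) with hv
  have hmax : ContinuousOn (fun s : ℝ => max s 0) univ := by fun_prop
  have hcont : ∀ Θ : ℝ → H, ContinuousOn Θ (Ici 0) → Continuous fun s : ℝ => Θ (max s 0) :=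
    fun Θ hΘ => continuousOn_univ.1 (hΘ.comp hmax fun s _ => le_max_right s 0)
  have hvc : Continuous v := (hcont Φ hΦ.continuous).sub (hcont Ψ hΨ.continuous)
  have hder : ∀ s, HasDerivAt (fun s => ∫ r in (0 : ℝ)..s, v r) (v s) s := fun s =>
    (hvc.integral_hasStrictDerivAt 0 s).hasDerivAt
  -- The integrated weak equation says that `V = ∫₀ˢ v` satisfies `A V = v = V'` when tested on the
  -- adjoint. Hence `V` is a strong trajectory from zero, so it vanishes, and so does its derivative
  -- `v`.
  have hgraph : ∀ s, 0 ≤ s → (∫ r in (0 : ℝ)..s, v r, v s) ∈ A.graph := by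
    intro s hs
    refine hA.mem_graph_of_adjointPair fun y y' hy => ?_
    have hint : ∀ Θ : ℝ → H, ContinuousOn Θ (Ici 0) →
        IntervalIntegrable (fun r => ⟪y', Θ r⟫_ℂ) volume 0 s := fun Θ hΘ => by
      refine ContinuousOn.intervalIntegrable ?_
      rw [uIcc_of_le hs]
      exact continuousOn_const.inner (hΘ.mono Icc_subset_Ici_self)
    have e := (innerSL ℂ y').intervalIntegral_comp_comm
      (hvc.intervalIntegrable (μ := volume) 0 s)
    refine Eq.trans ?_ e
    rw [hv]
    simp only [max_eq_left hs]
    rw [inner_sub_right, hΦ.equation y y' hy s hs, hΨ.equation y y' hy s hs,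
      add_sub_add_left_eq_sub, ← intervalIntegral.integral_sub (hint Φ hΦ.continuous)
        (hint Ψ hΨ.continuous)]
    refine intervalIntegral.integral_congr fun r hr => ?_
    rw [uIcc_of_le hs] at hr
    simp only [innerSL_apply_apply, max_eq_left hr.1, inner_sub_right]
  have hzero : ∀ s ∈ Ici (0 : ℝ), ∫ r in (0 : ℝ)..s, v r = 0 := fun s hs =>
    hA.eq_zero_of_hasDerivWithinAt (u := fun s => ∫ r in (0 : ℝ)..s, v r) (by simp) hgraph
      (fun s _ => (hder s).hasDerivWithinAt) hs
  have h1 : HasDerivWithinAt (fun s => ∫ r in (0 : ℝ)..s, v r) 0 (Ici 0) t :=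
    (hasDerivWithinAt_const t (Ici 0) (0 : H)).congr hzero (hzero t ht)
  have h2 := (uniqueDiffOn_Ici (0 : ℝ) t ht).eq_deriv _ (hder t).hasDerivWithinAt h1
  simp only [hv, max_eq_left ht] at h2
  exact sub_eq_zero.1 h2

end IsMDissipative

/-- A Lax-Milgram lemma: `I + J* (r² + r B) J` is onto if `B` is accretive. -/
lemma exists_inner_add_inner_eq {J B : H →L[ℂ] H} (hB : ∀ x, 0 ≤ (⟪B x, x⟫_ℂ).re) {r : ℝ}
    (hr : 0 < r) (y : H) :
    ∃ x, ∀ k, ⟪k, x⟫_ℂ + ⟪J k, ((r : ℂ) ^ 2) • J x + (r : ℂ) • B (J x)⟫_ℂ = ⟪J k, y⟫_ℂ := by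
  set K : H →L[ℂ] H := 1 + J.adjoint.comp ((((r : ℂ) ^ 2) • 1 + (r : ℂ) • B).comp J) with hK
  have hKx : ∀ x, K x = x + J.adjoint (((r : ℂ) ^ 2) • J x + (r : ℂ) • B (J x)) := fun x => rfl
  have hunit : IsUnit K := by
    -- Coercivity with constant `1`: `Re ⟨K x, x⟩ = ‖x‖² + r² ‖J x‖² + r Re ⟨B J x, J x⟩`.
    refine K.isUnit_of_forall_le_norm_inner_map (c := 1) zero_lt_one fun x => ?_
    rw [NNReal.coe_one, mul_one]
    refine le_trans ?_ (Complex.re_le_norm _)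
    have e1 : ∀ w : H, (⟪w, w⟫_ℂ).re = ‖w‖ ^ 2 := inner_self_eq_norm_sq (𝕜 := ℂ)
    rw [hKx, inner_add_left, ContinuousLinearMap.adjoint_inner_left, inner_add_left,
      inner_smul_left, inner_smul_left, ← Complex.ofReal_pow, Complex.conj_ofReal,
      Complex.conj_ofReal, Complex.add_re, Complex.add_re, Complex.re_ofReal_mul,
      Complex.re_ofReal_mul, e1, e1]
    have h1 := mul_nonneg hr.le (hB (J x))
    have h2 : 0 ≤ r ^ 2 * ‖J x‖ ^ 2 := by positivity
    linarith
  obtain ⟨x, hx⟩ := (ContinuousLinearMap.isUnit_iff_bijective.1 hunit).2 (J.adjoint y)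
  refine ⟨x, fun k => ?_⟩
  rw [← ContinuousLinearMap.adjoint_inner_right, ← ContinuousLinearMap.adjoint_inner_right,
    ← hx, hKx, inner_add_right]

end Semigroup

/-! ### Weak formulation of the Dirichlet Laplacian -/

section WeakLaplacian

variable {N : ℕ} {Ω : Opens (Space N)} {f : Space N → ℂ}

lemma pd_conj (hf : IsTest Ω f) (i : Fin N) :
    pd i (fun x => (starRingEnd ℂ) (f x)) = fun x => (starRingEnd ℂ) (pd i f x) := by
  funext x
  have h := (Complex.conjCLE : ℂ →L[ℝ] ℂ).hasFDerivAt.comp x (hf.diff x).hasFDerivAt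
  have h' : HasFDerivAt (fun x => (starRingEnd ℂ) (f x))
      ((Complex.conjCLE : ℂ →L[ℝ] ℂ).comp (fderiv ℝ f x)) x := h
  simp [pd, h'.fderiv]

lemma IsTest.conj (hf : IsTest Ω f) : IsTest Ω (fun x => (starRingEnd ℂ) (f x)) :=
  ⟨Complex.conjCLE.contDiff.comp hf.smooth,
    hf.compact.comp_left (g := starRingEnd ℂ) (map_zero _),
    (closure_mono fun x hx => by simpa using hx).trans hf.supp⟩

lemma inner_of_ae_eq {q : L2 Ω} (hq : q =ᵐ[volume.restrict (Ω : Set (Space N))] f) (w : L2 Ω) :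
    ⟪q, w⟫_ℂ = ∫ x in (Ω : Set (Space N)), w x * (starRingEnd ℂ) (f x) := by
  rw [L2.inner_def]
  refine integral_congr_ae ?_
  filter_upwards [hq] with x hx
  rw [hx]
  rfl

lemma integral_mul_lap (u : H01 Ω) (hf : IsTest Ω f) :
    ∫ x in (Ω : Set (Space N)), (u : L2 Ω) x * lap f x
      = - ∑ i, ∫ x in (Ω : Set (Space N)), grad u i x * pd i f x := by
  simp only [lap, Finset.mul_sum]
  rw [integral_finsetSum _ fun i _ => integrable_mul_test (u : L2 Ω) ((hf.pd i).pd i),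
    ← Finset.sum_neg_distrib]
  exact Finset.sum_congr rfl fun i _ => gradient_weak (mem_closure_grad u) (hf.pd i) i

/-- Green's formula against a conjugated test function. -/
lemma inner_grad_of_ae_eq (u : H01 Ω) (hf : IsTest Ω f) {G : L2Vec Ω}
    (hG : ∀ i, G i =ᵐ[volume.restrict (Ω : Set (Space N))] pd i f) :
    ⟪G, grad u⟫_ℂ = - ∫ x in (Ω : Set (Space N)),
      (u : L2 Ω) x * lap (fun x => (starRingEnd ℂ) (f x)) x := by
  rw [integral_mul_lap u hf.conj, neg_neg, PiLp.inner_apply]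
  refine Finset.sum_congr rfl fun i _ => ?_
  rw [inner_of_ae_eq (hG i), pd_conj hf]

lemma exists_H01_of_test (hf : IsTest Ω f) : ∃ g : H01 Ω,
    (g : L2 Ω) =ᵐ[volume.restrict (Ω : Set (Space N))] f ∧
    ∀ i, grad g i =ᵐ[volume.restrict (Ω : Set (Space N))] pd i f := by
  let G : L2Vec Ω := WithLp.toLp 2 fun i => ((hf.pd i).memLp 2 _).toLp (pd i f)
  have hmem : ((hf.memLp 2 _).toLp f, G) ∈ (gradient Ω).graph := by
    rw [gradient_graph]
    exact (testGraph Ω).le_topologicalClosure ⟨f, hf, MemLp.coeFn_toLp (hf.memLp 2 _),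
      fun i => MemLp.coeFn_toLp ((hf.pd i).memLp 2 _)⟩
  obtain ⟨g, hg, hg'⟩ := (gradient Ω).mem_graph_iff.1 hmem
  refine ⟨g, ?_, fun i => ?_⟩
  · rw [hg]
    exact MemLp.coeFn_toLp (hf.memLp 2 _)
  · change (gradient Ω g) i =ᵐ[_] _
    rw [hg']
    exact MemLp.coeFn_toLp ((hf.pd i).memLp 2 _)

/-- For `u ∈ H¹₀`, the distributional equation `Δu = w` is the weak equation tested on `H¹₀`. -/
lemma mem_laplacianGraph_iff (u : H01 Ω) (w : L2 Ω) :
    ((u : L2 Ω), w) ∈ laplacianGraph Ω ↔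
      ∀ g : H01 Ω, ⟪grad g, grad u⟫_ℂ = -⟪(g : L2 Ω), w⟫_ℂ := by
  constructor
  · intro h g
    -- The identity is a closed condition on `(g, ∇g)`, and such pairs are limits of test functions
    -- with their gradients.
    have hcl : IsClosed {q : L2 Ω × L2Vec Ω | ⟪q.2, grad u⟫_ℂ = -⟪q.1, w⟫_ℂ} :=
      isClosed_eq (continuous_snd.inner continuous_const)
        (continuous_fst.inner continuous_const).neg
    have hsub : (testGraph Ω : Set (L2 Ω × L2Vec Ω)) ⊆ {q | ⟪q.2, grad u⟫_ℂ = -⟪q.1, w⟫_ℂ} := by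
      rintro q ⟨f, hf, hq, hq'⟩
      rw [mem_ofPred_eq, inner_grad_of_ae_eq u hf hq', inner_of_ae_eq hq, h _ hf.conj]
    have hm := closure_minimal hsub hcl (mem_closure_grad g)
    exact hm
  · intro h f hf
    -- The conjugate is used because the inner product is antilinear in its first argument, while
    -- the distributional pairing is bilinear.
    obtain ⟨g, hg, hg'⟩ := exists_H01_of_test hf.conj
    have h1 := h g
    rw [inner_grad_of_ae_eq u hf.conj hg', inner_of_ae_eq hg, neg_inj] at h1
    simpa only [Complex.conj_conj] using h1

lemma laplacian_mem (u : (laplacian Ω).domain) : ((u : L2 Ω), laplacian Ω u) ∈ laplacianGraph Ω := by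
  rw [← laplacian_graph]
  exact (laplacian Ω).mem_graph u

lemma exists_laplacian_eq {u w : L2 Ω} (h : (u, w) ∈ laplacianGraph Ω) :
    ∃ hu : u ∈ (laplacian Ω).domain, laplacian Ω ⟨u, hu⟩ = w := by
  rw [← laplacian_graph] at h
  obtain ⟨q, hq, hq'⟩ := (laplacian Ω).mem_graph_iff.1 h
  cases hq
  exact ⟨q.2, hq'⟩

end WeakLaplacian

/-! ### Multiplication operators -/

section Coef

variable {m : ℕ} {U : Opens (Space m)}

lemma mulCoef_coe (b : LInf) (u : L2 (cyl U)) :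
    mulCoef U b u =ᵐ[volume.restrict (cyl U : Set (Space (m + 1)))]
      fun X => (b (X 0) : ℂ) * u X :=
  MemLp.coeFn_toLp (memLp_coef U b u)

/-- The coefficient is real. Besides cancelling the coupling terms, symmetry yields boundedness by
Hellinger-Toeplitz. -/
lemma mulCoef_isSymmetric (b : LInf) : (mulCoef U b).IsSymmetric := by
  intro u w
  rw [L2.inner_def, L2.inner_def]
  refine integral_congr_ae ?_
  filter_upwards [mulCoef_coe b u, mulCoef_coe b w] with X hu hw
  rw [hu, hw, ← smul_eq_mul, ← smul_eq_mul, inner_smul_left, inner_smul_right,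
    Complex.conj_ofReal]

lemma re_inner_mulCoef_nonneg {b : LInf}
    (hb : ∀ᵐ x ∂(volume.restrict (Ioo (0 : ℝ) 1)), 0 ≤ b x) (u : L2 (cyl U)) :
    0 ≤ (⟪mulCoef U b u, u⟫_ℂ).re := by
  have h : ⟪mulCoef U b u, u⟫_ℂ
      = ∫ X in (cyl U : Set (Space (m + 1))), ((b (X 0) * ‖u X‖ ^ 2 : ℝ) : ℂ) := by
    rw [L2.inner_def]
    refine integral_congr_ae ?_
    filter_upwards [mulCoef_coe b u] with X hu
    rw [hu, ← smul_eq_mul, inner_smul_left, Complex.conj_ofReal, inner_self_eq_norm_sq_to_K]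
    simp
  rw [h, integral_complex_ofReal, Complex.ofReal_re]
  refine integral_nonneg_of_ae ?_
  filter_upwards [(quasi_fst U).ae hb] with X hX
  exact mul_nonneg hX (sq_nonneg _)

/-- Multiplication by a bounded coefficient as a bounded operator. -/
def mulCoefL (U : Opens (Space m)) (b : LInf) : L2 (cyl U) →L[ℂ] L2 (cyl U) :=
  ⟨mulCoef U b, (mulCoef_isSymmetric b).continuous⟩

end Coef

/-! ### Completeness of the energy space -/

namespace EnergySpace

variable {m : ℕ} {U : Opens (Space m)} {a : ℝ} {ha : 0 < a}

lemma inner_def (Φ Ψ : EnergySpace U ha) : ⟪Φ, Ψ⟫_ℂ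
    = ⟪grad Φ.phi, grad Ψ.phi⟫_ℂ + ⟪Φ.v, Ψ.v⟫_ℂ
      + (a : ℂ) * ⟪grad Φ.psi, grad Ψ.psi⟫_ℂ + ⟪Φ.z, Ψ.z⟫_ℂ := rfl

lemma norm_sq_eq (Φ : EnergySpace U ha) :
    ‖Φ‖ ^ 2 = ‖grad Φ.phi‖ ^ 2 + ‖Φ.v‖ ^ 2 + a * ‖grad Φ.psi‖ ^ 2 + ‖Φ.z‖ ^ 2 := by
  have h := inner_self_eq_norm_sq (𝕜 := ℂ) Φ
  rw [← h, inner_def]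
  simp only [map_add, RCLike.re_to_complex, Complex.re_ofReal_mul]
  rw [← inner_self_eq_norm_sq (𝕜 := ℂ) (grad Φ.phi), ← inner_self_eq_norm_sq (𝕜 := ℂ) Φ.v,
    ← inner_self_eq_norm_sq (𝕜 := ℂ) (grad Φ.psi), ← inner_self_eq_norm_sq (𝕜 := ℂ) Φ.z]
  rfl

lemma norm_grad_phi_le (Φ : EnergySpace U ha) : ‖grad Φ.phi‖ ≤ ‖Φ‖ := by
  refine le_of_sq_le_sq ?_ (norm_nonneg _)
  rw [norm_sq_eq]
  have := mul_nonneg ha.le (sq_nonneg ‖grad Φ.psi‖)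
  linarith [sq_nonneg ‖Φ.v‖, sq_nonneg ‖Φ.z‖]

lemma norm_v_le (Φ : EnergySpace U ha) : ‖Φ.v‖ ≤ ‖Φ‖ := by
  refine le_of_sq_le_sq ?_ (norm_nonneg _)
  rw [norm_sq_eq]
  have := mul_nonneg ha.le (sq_nonneg ‖grad Φ.psi‖)
  linarith [sq_nonneg ‖grad Φ.phi‖, sq_nonneg ‖Φ.z‖]

lemma norm_z_le (Φ : EnergySpace U ha) : ‖Φ.z‖ ≤ ‖Φ‖ := by
  refine le_of_sq_le_sq ?_ (norm_nonneg _)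
  rw [norm_sq_eq]
  have := mul_nonneg ha.le (sq_nonneg ‖grad Φ.psi‖)
  linarith [sq_nonneg ‖grad Φ.phi‖, sq_nonneg ‖Φ.v‖]

lemma norm_grad_psi_le (Φ : EnergySpace U ha) : ‖grad Φ.psi‖ ≤ (√a)⁻¹ * ‖Φ‖ := by
  rw [← div_eq_inv_mul, le_div_iff₀' (Real.sqrt_pos.2 ha)]
  refine le_of_sq_le_sq ?_ (norm_nonneg _)
  rw [mul_pow, Real.sq_sqrt ha.le, norm_sq_eq]
  linarith [sq_nonneg ‖grad Φ.phi‖, sq_nonneg ‖Φ.v‖, sq_nonneg ‖Φ.z‖]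

variable (U ha)

/-- `Φ ↦ ∇φ`. -/
def gradPhiL : EnergySpace U ha →L[ℂ] L2Vec (cyl U) :=
  LinearMap.mkContinuous
    { toFun := fun Φ => grad Φ.phi
      map_add' := fun Φ Ψ => map_add grad Φ.phi Ψ.phi
      map_smul' := fun r Φ => map_smul grad r Φ.phi } 1
    fun Φ => by rw [one_mul]; exact norm_grad_phi_le Φ

/-- `Φ ↦ ∇ψ`. -/
def gradPsiL : EnergySpace U ha →L[ℂ] L2Vec (cyl U) :=
  LinearMap.mkContinuous
    { toFun := fun Φ => grad Φ.psi
      map_add' := fun Φ Ψ => map_add grad Φ.psi Ψ.psi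
      map_smul' := fun r Φ => map_smul grad r Φ.psi } (√a)⁻¹ norm_grad_psi_le

/-- `Φ ↦ φ`. -/
def phiL : EnergySpace U ha →L[ℂ] L2 (cyl U) :=
  LinearMap.mkContinuous
    { toFun := fun Φ => (Φ.phi : L2 (cyl U))
      map_add' := fun _ _ => rfl
      map_smul' := fun _ _ => rfl } 1
    fun Φ => by rw [one_mul]; exact (poincare Φ.phi).trans (norm_grad_phi_le Φ)

/-- `Φ ↦ ψ`. -/
def psiL : EnergySpace U ha →L[ℂ] L2 (cyl U) :=
  LinearMap.mkContinuous
    { toFun := fun Φ => (Φ.psi : L2 (cyl U))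
      map_add' := fun _ _ => rfl
      map_smul' := fun _ _ => rfl } (√a)⁻¹
    fun Φ => (poincare Φ.psi).trans (norm_grad_psi_le Φ)

/-- `Φ ↦ v`. -/
def vL : EnergySpace U ha →L[ℂ] L2 (cyl U) :=
  LinearMap.mkContinuous
    { toFun := fun Φ => Φ.v
      map_add' := fun _ _ => rfl
      map_smul' := fun _ _ => rfl } 1
    fun Φ => by rw [one_mul]; exact norm_v_le Φ

/-- `Φ ↦ z`. -/
def zL : EnergySpace U ha →L[ℂ] L2 (cyl U) :=
  LinearMap.mkContinuous
    { toFun := fun Φ => Φ.z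
      map_add' := fun _ _ => rfl
      map_smul' := fun _ _ => rfl } 1
    fun Φ => by rw [one_mul]; exact norm_z_le Φ

variable {U ha}

/-- The element `(φ, v, ψ, z)`. -/
def mk (φ : H01 (cyl U)) (v : L2 (cyl U)) (ψ : H01 (cyl U)) (z : L2 (cyl U)) :
    EnergySpace U ha := (φ, v, ψ, z)

lemma ext {Φ Ψ : EnergySpace U ha} (h1 : Φ.phi = Ψ.phi) (h2 : Φ.v = Ψ.v) (h3 : Φ.psi = Ψ.psi)
    (h4 : Φ.z = Ψ.z) : Φ = Ψ :=
  Prod.ext h1 (Prod.ext h2 (Prod.ext h3 h4))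

lemma norm_mk_v (v : L2 (cyl U)) : ‖(mk 0 v 0 0 : EnergySpace U ha)‖ = ‖v‖ := by
  refine (sq_eq_sq₀ (norm_nonneg _) (norm_nonneg _)).1 ?_
  rw [norm_sq_eq]
  simp [mk, phi, psi, EnergySpace.v, z]

lemma norm_mk_z (z : L2 (cyl U)) : ‖(mk 0 0 0 z : EnergySpace U ha)‖ = ‖z‖ := by
  refine (sq_eq_sq₀ (norm_nonneg _) (norm_nonneg _)).1 ?_
  rw [norm_sq_eq]
  simp [mk, phi, psi, v, EnergySpace.z]

variable (U ha)

/-- `v ↦ (0, v, 0, 0)`. -/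
def inV : L2 (cyl U) →L[ℂ] EnergySpace U ha :=
  LinearMap.mkContinuous
    { toFun := fun v => mk 0 v 0 0
      map_add' := fun _ _ => ext (add_zero 0).symm rfl (add_zero 0).symm (add_zero 0).symm
      map_smul' := fun r _ => ext (smul_zero r).symm rfl (smul_zero r).symm (smul_zero r).symm } 1
    fun v => by rw [one_mul]; exact (norm_mk_v v).le

/-- `z ↦ (0, 0, 0, z)`. -/
def inZ : L2 (cyl U) →L[ℂ] EnergySpace U ha :=
  LinearMap.mkContinuous
    { toFun := fun z => mk 0 0 0 z
      map_add' := fun _ _ => ext (add_zero 0).symm (add_zero 0).symm (add_zero 0).symm rfl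
      map_smul' := fun r _ => ext (smul_zero r).symm (smul_zero r).symm (smul_zero r).symm rfl } 1
    fun z => by rw [one_mul]; exact (norm_mk_z z).le

variable {U ha}

/-- By Poincaré the functions are Cauchy along with their gradients, and the graph of the gradient
is closed. -/
lemma exists_H01_limit {φ : ℕ → H01 (cyl U)} (h : CauchySeq fun n => grad (φ n)) :
    ∃ φ₀ : H01 (cyl U), Tendsto (fun n => grad (φ n)) atTop (𝓝 (grad φ₀)) := by
  obtain ⟨g, hg⟩ := cauchySeq_tendsto_of_complete h
  have hφ : CauchySeq fun n => (φ n : L2 (cyl U)) := by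
    rw [Metric.cauchySeq_iff] at h ⊢
    intro ε hε
    obtain ⟨n₀, hn₀⟩ := h ε hε
    refine ⟨n₀, fun n hn k hk => lt_of_le_of_lt ?_ (hn₀ n hn k hk)⟩
    rw [dist_eq_norm, dist_eq_norm, ← map_sub]
    exact poincare (φ n - φ k)
  obtain ⟨u, hu⟩ := cauchySeq_tendsto_of_complete hφ
  have hmem : (u, g) ∈ (gradient (cyl U)).graph := by
    rw [gradient_graph]
    exact (testGraph (cyl U)).isClosed_topologicalClosure.mem_of_tendsto (hu.prodMk_nhds hg)
      (Eventually.of_forall fun n => mem_closure_grad (φ n))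
  obtain ⟨φ₀, _, hφ₀⟩ := (gradient (cyl U)).mem_graph_iff.1 hmem
  exact ⟨φ₀, by rw [show grad φ₀ = g from hφ₀]; exact hg⟩

instance : CompleteSpace (EnergySpace U ha) := by
  refine Metric.complete_of_cauchySeq_tendsto fun Φ hΦ => ?_
  obtain ⟨φ, hφ⟩ := exists_H01_limit (φ := fun n => (Φ n).phi)
    (hΦ.map (gradPhiL U ha).uniformContinuous)
  obtain ⟨ψ, hψ⟩ := exists_H01_limit (φ := fun n => (Φ n).psi)
    (hΦ.map (gradPsiL U ha).uniformContinuous)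
  obtain ⟨v, hv⟩ := cauchySeq_tendsto_of_complete
    (u := fun n => (Φ n).v) (hΦ.map (vL U ha).uniformContinuous)
  obtain ⟨z, hz⟩ := cauchySeq_tendsto_of_complete
    (u := fun n => (Φ n).z) (hΦ.map (zL U ha).uniformContinuous)
  refine ⟨mk φ v ψ z, ?_⟩
  rw [tendsto_iff_norm_sub_tendsto_zero] at hφ hψ hv hz ⊢
  have h : Tendsto (fun n => ‖Φ n - mk φ v ψ z‖ ^ 2) atTop (𝓝 0) := by
    have h1 := (((hφ.pow 2).add (hv.pow 2)).add ((hψ.pow 2).const_mul a)).add (hz.pow 2)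
    simp only [ne_eq, OfNat.ofNat_ne_zero, not_false_eq_true, zero_pow, mul_zero, add_zero] at h1
    refine h1.congr fun n => ?_
    rw [norm_sq_eq, ← map_sub, ← map_sub]
    rfl
  have h2 := h.sqrt
  simpa only [Real.sqrt_sq (norm_nonneg _), Real.sqrt_zero] using h2

end EnergySpace

/-! ### The damped wave operator is m-dissipative -/

section WaveOp

variable {m : ℕ} {U : Opens (Space m)} {a : ℝ} {ha : 0 < a} {b c d : LInf}

open EnergySpace

lemma re_inner_mulCoef_swap (c : LInf) (v z : L2 (cyl U)) :
    (⟪mulCoef U c z, v⟫_ℂ).re = (⟪mulCoef U c v, z⟫_ℂ).re := by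
  rw [mulCoef_isSymmetric c z v, ← inner_conj_symm, Complex.conj_re]

/-- Green's formula, applied with `v` and `z` as test elements of `H¹₀`, cancels the gradient terms
against the Laplacians; the two coupling terms have equal real parts and opposite signs. -/
lemma re_inner_waveOp (Φ : (waveOp U ha b c d).domain) :
    (⟪waveOp U ha b c d Φ, (Φ : EnergySpace U ha)⟫_ℂ).re
      = -(⟪mulCoef U b Φ.1.v, Φ.1.v⟫_ℂ).re - (⟪mulCoef U d Φ.1.z, Φ.1.z⟫_ℂ).re := by
  obtain ⟨Φ, hφ, hv, hψ, hz⟩ := Φ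
  have h1 := (mem_laplacianGraph_iff Φ.phi _).1 (laplacian_mem ⟨_, hφ⟩) ⟨Φ.v, hv⟩
  have h2 := (mem_laplacianGraph_iff Φ.psi _).1 (laplacian_mem ⟨_, hψ⟩) ⟨Φ.z, hz⟩
  change (⟪grad ⟨Φ.v, hv⟩, grad Φ.phi⟫_ℂ
    + ⟪laplacian (cyl U) ⟨Φ.phi, hφ⟩ - mulCoef U b Φ.v - mulCoef U c Φ.z, Φ.v⟫_ℂ
    + (a : ℂ) * ⟪grad ⟨Φ.z, hz⟩, grad Φ.psi⟫_ℂ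
    + ⟪(a : ℂ) • laplacian (cyl U) ⟨Φ.psi, hψ⟩ - mulCoef U d Φ.z + mulCoef U c Φ.v, Φ.z⟫_ℂ).re = _
  rw [h1, h2]
  simp only [inner_sub_left, inner_add_left, inner_smul_left, Complex.conj_ofReal, Complex.add_re,
    Complex.sub_re, Complex.neg_re, Complex.re_ofReal_mul]
  have s1 : (⟪Φ.v, laplacian (cyl U) ⟨Φ.phi, hφ⟩⟫_ℂ).re
      = (⟪laplacian (cyl U) ⟨Φ.phi, hφ⟩, Φ.v⟫_ℂ).re := inner_re_symm (𝕜 := ℂ) _ _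
  have s2 : (⟪Φ.z, laplacian (cyl U) ⟨Φ.psi, hψ⟩⟫_ℂ).re
      = (⟪laplacian (cyl U) ⟨Φ.psi, hψ⟩, Φ.z⟫_ℂ).re := inner_re_symm (𝕜 := ℂ) _ _
  rw [s1, s2, re_inner_mulCoef_swap c Φ.v Φ.z]
  ring

variable (U ha b c d)

/-- The damping and coupling operator `(φ, v, ψ, z) ↦ (0, b v + c z, 0, d z - c v)`. -/
def dampingL : EnergySpace U ha →L[ℂ] EnergySpace U ha :=
  (inV U ha).comp ((mulCoefL U b).comp (vL U ha) + (mulCoefL U c).comp (zL U ha))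
    + (inZ U ha).comp ((mulCoefL U d).comp (zL U ha) - (mulCoefL U c).comp (vL U ha))

/-- The operator `(φ, v, ψ, z) ↦ (0, φ, 0, ψ)`. -/
def shiftL : EnergySpace U ha →L[ℂ] EnergySpace U ha :=
  (inV U ha).comp (phiL U ha) + (inZ U ha).comp (psiL U ha)

variable {U ha b c d}

lemma dampingL_apply (Φ : EnergySpace U ha) : dampingL U ha b c d Φ
    = EnergySpace.mk 0 (mulCoef U b Φ.v + mulCoef U c Φ.z) 0
      (mulCoef U d Φ.z - mulCoef U c Φ.v) :=
  EnergySpace.ext (add_zero 0) (add_zero _) (add_zero 0) (zero_add _)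

lemma shiftL_apply (Φ : EnergySpace U ha) :
    shiftL U ha Φ = EnergySpace.mk 0 (Φ.phi : L2 (cyl U)) 0 (Φ.psi : L2 (cyl U)) :=
  EnergySpace.ext (add_zero 0) (add_zero _) (add_zero 0) (zero_add _)

lemma inner_mk_zero (v z : L2 (cyl U)) (Φ : EnergySpace U ha) :
    ⟪(EnergySpace.mk 0 v 0 z : EnergySpace U ha), Φ⟫_ℂ = ⟪v, Φ.v⟫_ℂ + ⟪z, Φ.z⟫_ℂ := by
  rw [EnergySpace.inner_def]
  change ⟪grad 0, grad Φ.phi⟫_ℂ + ⟪v, Φ.v⟫_ℂ + (a : ℂ) * ⟪grad 0, grad Φ.psi⟫_ℂ + ⟪z, Φ.z⟫_ℂ = _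
  rw [map_zero, inner_zero_left, inner_zero_left, mul_zero, zero_add, add_zero]

lemma re_inner_dampingL_nonneg
    (hb : ∀ᵐ x ∂(volume.restrict (Ioo (0 : ℝ) 1)), 0 ≤ b x)
    (hd : ∀ᵐ x ∂(volume.restrict (Ioo (0 : ℝ) 1)), 0 ≤ d x) (Φ : EnergySpace U ha) :
    0 ≤ (⟪dampingL U ha b c d Φ, Φ⟫_ℂ).re := by
  rw [dampingL_apply, inner_mk_zero, inner_add_left, inner_sub_left]
  simp only [Complex.add_re, Complex.sub_re]
  rw [re_inner_mulCoef_swap c Φ.v Φ.z]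
  linarith [re_inner_mulCoef_nonneg hb Φ.v, re_inner_mulCoef_nonneg hd Φ.z]

/-- The first and third equations give `v = rφ - F.phi` and `z = rψ - F.psi`. Substituting leaves an
elliptic system for `(φ, ψ)`, whose weak form is the equation of `exists_inner_add_inner_eq` with `J
= shiftL` and `B = dampingL`. -/
lemma waveOp_range
    (hb : ∀ᵐ x ∂(volume.restrict (Ioo (0 : ℝ) 1)), 0 ≤ b x)
    (hd : ∀ᵐ x ∂(volume.restrict (Ioo (0 : ℝ) 1)), 0 ≤ d x) {r : ℝ} (hr : 0 < r)
    (F : EnergySpace U ha) :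
    ∃ Φ : (waveOp U ha b c d).domain, (r : ℂ) • (Φ : EnergySpace U ha) - waveOp U ha b c d Φ = F := by
  -- The right side collects `F` and the terms in `F.phi`, `F.psi` produced by the substitution.
  -- Only the components `φ`, `ψ` of the solution `Θ` are kept.
  obtain ⟨Θ, hΘ⟩ := exists_inner_add_inner_eq (J := shiftL U ha)
    (re_inner_dampingL_nonneg (c := c) hb hd) hr
    (F + ((r : ℂ) • shiftL U ha F + dampingL U ha b c d (shiftL U ha F)))
  set φ : H01 (cyl U) := Θ.phi with hφ
  set ψ : H01 (cyl U) := Θ.psi with hψ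
  set v : H01 (cyl U) := (r : ℂ) • φ - F.phi with hv
  set z : H01 (cyl U) := (r : ℂ) • ψ - F.psi with hz
  -- `w₁` and `w₂` are the values that the second and fourth equations impose on `Δφ` and `Δψ`.
  set w₁ : L2 (cyl U) := (r : ℂ) • (v : L2 (cyl U)) + mulCoef U b v + mulCoef U c z - F.v with hw₁
  set w₂ : L2 (cyl U) := (a : ℂ)⁻¹ • ((r : ℂ) • (z : L2 (cyl U)) + mulCoef U d z - mulCoef U c v
    - F.z) with hw₂
  have hvc : (v : L2 (cyl U)) = (r : ℂ) • (φ : L2 (cyl U)) - F.phi := rfl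
  have hzc : (z : L2 (cyl U)) = (r : ℂ) • (ψ : L2 (cyl U)) - F.psi := rfl
  have ha' : (a : ℂ) ≠ 0 := by exact_mod_cast ha.ne'
  have hm₁ : ((φ : L2 (cyl U)), w₁) ∈ laplacianGraph (cyl U) := by
    rw [mem_laplacianGraph_iff]
    intro g
    -- This test vector isolates the weak equation for `φ`; below, `(0, 0, g, 0)` isolates the one
    -- for `ψ`, whose gradient term carries the weight `a`.
    have h := hΘ (EnergySpace.mk g 0 0 0)
    rw [shiftL_apply (EnergySpace.mk g 0 0 0), inner_mk_zero, inner_mk_zero, shiftL_apply Θ,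
      shiftL_apply F, dampingL_apply, dampingL_apply, EnergySpace.inner_def] at h
    change ⟪grad g, grad φ⟫_ℂ + ⟪(0 : L2 (cyl U)), _⟫_ℂ + (a : ℂ) * ⟪grad 0, grad ψ⟫_ℂ
        + ⟪(0 : L2 (cyl U)), _⟫_ℂ
        + (⟪(g : L2 (cyl U)), (r : ℂ) ^ 2 • (φ : L2 (cyl U))
            + (r : ℂ) • (mulCoef U b φ + mulCoef U c ψ)⟫_ℂ + ⟪(0 : L2 (cyl U)), _⟫_ℂ)
      = ⟪(g : L2 (cyl U)), F.v + ((r : ℂ) • (F.phi : L2 (cyl U))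
            + (mulCoef U b F.phi + mulCoef U c F.psi))⟫_ℂ + ⟪(0 : L2 (cyl U)), _⟫_ℂ at h
    rw [map_zero] at h
    simp only [inner_zero_left, mul_zero, add_zero] at h
    have e : w₁ = ((r : ℂ) ^ 2 • (φ : L2 (cyl U)) + (r : ℂ) • (mulCoef U b φ + mulCoef U c ψ))
        - (F.v + ((r : ℂ) • (F.phi : L2 (cyl U)) + (mulCoef U b F.phi + mulCoef U c F.psi))) := by
      rw [hw₁, hvc, hzc, map_sub, map_sub, map_smul, map_smul]
      module
    rw [e, inner_sub_right]
    linear_combination h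
  have hm₂ : ((ψ : L2 (cyl U)), w₂) ∈ laplacianGraph (cyl U) := by
    rw [mem_laplacianGraph_iff]
    intro g
    have h := hΘ (EnergySpace.mk 0 0 g 0)
    rw [shiftL_apply (EnergySpace.mk 0 0 g 0), inner_mk_zero, inner_mk_zero, shiftL_apply Θ,
      shiftL_apply F, dampingL_apply, dampingL_apply, EnergySpace.inner_def] at h
    change ⟪grad 0, grad φ⟫_ℂ + ⟪(0 : L2 (cyl U)), _⟫_ℂ + (a : ℂ) * ⟪grad g, grad ψ⟫_ℂ
        + ⟪(0 : L2 (cyl U)), _⟫_ℂ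
        + (⟪(0 : L2 (cyl U)), _⟫_ℂ + ⟪(g : L2 (cyl U)), (r : ℂ) ^ 2 • (ψ : L2 (cyl U))
            + (r : ℂ) • (mulCoef U d ψ - mulCoef U c φ)⟫_ℂ)
      = ⟪(0 : L2 (cyl U)), _⟫_ℂ + ⟪(g : L2 (cyl U)), F.z + ((r : ℂ) • (F.psi : L2 (cyl U))
            + (mulCoef U d F.psi - mulCoef U c F.phi))⟫_ℂ at h
    rw [map_zero] at h
    simp only [inner_zero_left, add_zero, zero_add] at h
    have e : w₂ = (a : ℂ)⁻¹ • (((r : ℂ) ^ 2 • (ψ : L2 (cyl U))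
          + (r : ℂ) • (mulCoef U d ψ - mulCoef U c φ))
        - (F.z + ((r : ℂ) • (F.psi : L2 (cyl U)) + (mulCoef U d F.psi - mulCoef U c F.phi)))) := by
      rw [hw₂, hvc, hzc, map_sub, map_sub, map_smul, map_smul]
      module
    rw [e, inner_smul_right, inner_sub_right]
    refine mul_left_cancel₀ ha' ?_
    rw [mul_neg, mul_inv_cancel_left₀ ha']
    linear_combination h
  obtain ⟨h₁, e₁⟩ := exists_laplacian_eq hm₁
  obtain ⟨h₂, e₂⟩ := exists_laplacian_eq hm₂
  refine ⟨⟨EnergySpace.mk φ v ψ z, h₁, v.2, h₂, z.2⟩, ?_⟩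
  refine EnergySpace.ext ?_ ?_ ?_ ?_
  · change (r : ℂ) • φ - v = F.phi
    rw [hv, sub_sub_cancel]
  · change (r : ℂ) • (v : L2 (cyl U))
      - (laplacian (cyl U) ⟨φ, h₁⟩ - mulCoef U b v - mulCoef U c z) = F.v
    rw [e₁, hw₁]
    abel
  · change (r : ℂ) • ψ - z = F.psi
    rw [hz, sub_sub_cancel]
  · change (r : ℂ) • (z : L2 (cyl U))
      - ((a : ℂ) • laplacian (cyl U) ⟨ψ, h₂⟩ - mulCoef U d z + mulCoef U c v) = F.z
    rw [e₂, hw₂, smul_inv_smul₀ ha']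
    abel

lemma waveOp_isMDissipative
    (hb : ∀ᵐ x ∂(volume.restrict (Ioo (0 : ℝ) 1)), 0 ≤ b x)
    (hd : ∀ᵐ x ∂(volume.restrict (Ioo (0 : ℝ) 1)), 0 ≤ d x) :
    IsMDissipative (waveOp U ha b c d) where
  dissipative Φ := by
    rw [re_inner_waveOp]
    linarith [re_inner_mulCoef_nonneg hb Φ.1.v, re_inner_mulCoef_nonneg hd Φ.1.z]
  range_eq _ hr F := waveOp_range hb hd hr F

end WaveOp

end

end CoupledWave

theorem proposition2p1 {m : ℕ} (hm : 1 ≤ m) (U : Opens (Space m)) (hU : (U : Set (Space m)).Nonempty)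
    {a : ℝ} (ha : 0 < a) (b c d : LInf)
    (hb : ∀ᵐ x ∂(volume.restrict (Ioo (0 : ℝ) 1)), 0 ≤ b x)
    (hd : ∀ᵐ x ∂(volume.restrict (Ioo (0 : ℝ) 1)), 0 ≤ d x) :
    IsMDissipative (waveOp U ha b c d) ∧
    ∃ T : ℝ → EnergySpace U ha →L[ℂ] EnergySpace U ha,
      IsContractionSemigroup T ∧ IsGenerator (waveOp U ha b c d) T ∧
      (∀ Φ₀ : EnergySpace U ha,
        IsWeakSolution (waveOp U ha b c d) Φ₀ (fun t => T t Φ₀) ∧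
        ∀ Φ : ℝ → EnergySpace U ha, IsWeakSolution (waveOp U ha b c d) Φ₀ Φ →
          ∀ t : ℝ, 0 ≤ t → Φ t = T t Φ₀) ∧
      (∀ Φ₀ : EnergySpace U ha, Φ₀ ∈ (waveOp U ha b c d).domain →
        IsStrongSolution (waveOp U ha b c d) Φ₀ (fun t => T t Φ₀) ∧
        ContDiffOn ℝ 1 (fun t => T t Φ₀) (Ici 0) ∧
        ContinuousInDomain (waveOp U ha b c d) (fun t => T t Φ₀) ∧
        ∀ Φ : ℝ → EnergySpace U ha, IsStrongSolution (waveOp U ha b c d) Φ₀ Φ →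
          ∀ t : ℝ, 0 ≤ t → Φ t = T t Φ₀) := by
  have hA := waveOp_isMDissipative (U := U) (ha := ha) (c := c) hb hd
  refine ⟨hA, hA.semigroup, hA.isContractionSemigroup, hA.isGenerator, fun Φ₀ =>
    ⟨hA.isWeakSolution_semigroup Φ₀, fun Φ hΦ t ht =>
      hA.weakSolution_unique hΦ (hA.isWeakSolution_semigroup Φ₀) ht⟩, fun Φ₀ hΦ₀ => ?_⟩
  have hg := (waveOp U ha b c d).mem_graph ⟨Φ₀, hΦ₀⟩
  exact ⟨hA.isStrongSolution_semigroup hg, hA.contDiffOn_semigroup hg,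
    hA.continuousInDomain_semigroup hg, fun Φ hΦ t ht =>
      hA.strongSolution_unique hΦ (hA.isStrongSolution_semigroup hg) ht⟩
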